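/- **Definitions.** Let $\Sigma$ be a finite alphabet. An $X$-labeled automaton has a finite state set $Q$, a set of initial states, a transition relation $\delta\subseteq Q\times\Sigma\times Q$, a set of accepting states and a labeling $\delta\to X$. It is deterministic if it has exactly one initial state and at most one successor for each state and letter. A nested automaton $\mathbb{A}$ consists of a *master* automaton, labeled by the indices $1,\dots,l$, and of *slave* automata $\mathfrak{B}_1,\dots,\mathfrak{B}_l$ with integer labels (weights). A run of $\mathbb{A}$ on an infinite word $w=w_0w_1\cdots$ is a run of the master on $w$ together with, for each position $p$, a run of the slave $\mathfrak{B}_i$ on some finite word $w_p\cdots w_{p+\ell_p-1}$, where $i$ is the label of the master transition at $p$. If $\ell_p=0$ the slave is silent. The run is accepting if some accepting state occurs infinitely often in the master's run, each slave run ends in an accepting state, and $\ell_p>0$ for infinitely many $p$. The value of a slave run is the sum of its weights; the value of an accepting run is $\liminf_{n\to\infty}\frac1n\sum_{i=1}^n v_i\in[-\infty,\infty]$, where $v_i$ is the value of the $i$-th non-silent slave run in order of invocation. The value $\mathbb{A}(w)$ is the infimum of the values of the accepting runs on $w$ ($+\infty$ if there are none, that is, if $w$ is not accepted). This is a $(\mathrm{LimAvg};\mathrm{Sum})$-automaton;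 it is *deterministic* if the master and all slaves are deterministic and the slaves recognize prefix-free languages of finite words. $\mathbb{A}$ has *width* $k$ if in each accepting run, before each position $b$, at most $k$ slaves are running (invoked at some $p<b$ with $b<p+\ell_p$). A *configuration* is a tuple $(q;q_1,\dots,q_k)$ of a master state $q$ and entries $q_j$, each a state of one of the slaves or $\bot$, the entries $\bot$ coming last; $\mathrm{Conf}(\mathbb{A})$ is the number of configurations. A slave invoked at $p$ is *active* at position $b$ if $p\le b<p+\ell_p$. Let $C$ be the minimal weight of a slave transition. *Condition (\*)*: $C<0$, and there are an accepted word $w$ and infinitely many positions $b$ such that the sum of the weights that the slaves active at $b$ accumulate on $w_bw_{b+1}\cdots$ is smaller than $C\cdot k^2\cdot\mathrm{Conf}(\mathbb{A})$. A word is *dense* if it is accepted and in its accepting run the $i$-th non-silent slave takes $O(\log i)$ steps as $i\to\infty$. **Lemma.** Let $k>0$ and let $\mathbb{A}$ be a deterministic $(\mathrm{LimAvg};\mathrm{Sum})$-automaton of width $k$ for which condition (\*) does not hold. Then: 1. If $\mathbb{A}$ accepts at least one word, then $\inf_{u\in\Sigma^\omega}\mathbb{A}(u)$ is finite and for every $\varepsilon>0$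 there are finite words $\alpha,\beta$, with $\beta$ non-empty, such that $\mathbb{A}(\alpha\beta^\omega)$ is finite and $|\inf_{u\in\Sigma^\omega}\mathbb{A}(u)-\mathbb{A}(\alpha\beta^\omega)|<\varepsilon$. 2. $\inf_{u\in\Sigma^\omega}\mathbb{A}(u)>-\infty$. 3. If $\mathbb{A}$ accepts at least one word, then there is a dense word $w_d$ with $\inf_{u\in\Sigma^\omega}\mathbb{A}(u)=\mathbb{A}(w_d)$. -/

import Mathlib

open Filter Asymptotics

/-- A labeled automaton over the alphabet `A` with states `Q` and labels in `X`: initial states,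
transition relation, accepting states and the labels of the transitions. Only the labels of
triples in `trans` matter. -/
structure LabeledAutomaton (A Q X : Type*) where
  init : Set Q
  trans : Q → A → Q → Prop
  acc : Set Q
  label : Q → A → Q → X

namespace LabeledAutomaton

variable {A Q X : Type*}

/-- `π` is a run on the infinite word `w`. -/
def IsRun (M : LabeledAutomaton A Q X) (w : ℕ → A) (π : ℕ → Q) : Prop :=
  π 0 ∈ M.init ∧ ∀ i, M.trans (π i) (w i) (π (i + 1))

/-- Büchi acceptance: some accepting state occurs infinitely often in `π`. -/
def IsBuchiAccepting (M : LabeledAutomaton A Q X) (π : ℕ → Q) : Prop :=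
  ∃ q ∈ M.acc, ∃ᶠ i in atTop, π i = q

/-- `π 0, …, π n` is a run on the finite word `u 0, …, u (n - 1)`
(the other entries of `u` and `π` play no role). -/
def IsFinRun (M : LabeledAutomaton A Q X) (u : ℕ → A) (n : ℕ) (π : ℕ → Q) : Prop :=
  π 0 ∈ M.init ∧ ∀ j < n, M.trans (π j) (u j) (π (j + 1))

/-- The finite word `u` is accepted: some run on `u` ends in an accepting state. -/
def AcceptsFin (M : LabeledAutomaton A Q X) (u : List A) : Prop :=
  ∃ π : ℕ → Q, π 0 ∈ M.init ∧
    (∀ j (h : j < u.length), M.trans (π j) (u[j]) (π (j + 1))) ∧ π u.length ∈ M.acc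

/-- The language of finite words is prefix-free: no proper extension of an accepted word is
accepted. -/
def PrefixFree (M : LabeledAutomaton A Q X) : Prop :=
  ∀ u v : List A, M.AcceptsFin u → M.AcceptsFin (u ++ v) → v = []

/-- One initial state, and at most one successor for each state and letter (the transition
function may be partial; total ones are included). -/
def Deterministic (M : LabeledAutomaton A Q X) : Prop :=
  (∃ q, M.init = {q}) ∧
    ∀ q a q₁ q₂, M.trans q a q₁ → M.trans q a q₂ → q₁ = q₂

end LabeledAutomaton

/-- A nested weighted automaton: a master automaton whose labels are indices of slave automata,
and a family of integer-weighted slave automata. -/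
structure NWA (A Q ι : Type*) (S : ι → Type*) where
  master : LabeledAutomaton A Q ι
  slave : ∀ i, LabeledAutomaton A (S i) ℤ

/-- The limit average of a sequence of integers, an extended real. -/
noncomputable def limAvg (x : ℕ → ℤ) : EReal :=
  liminf (fun n : ℕ => (((∑ i ∈ Finset.range n, (x i : ℝ)) / n : ℝ) : EReal)) atTop

/-- The word `α β β β …`. -/
def lasso {A : Type*} (α β : List A) (hβ : β ≠ []) : ℕ → A := fun n =>
  if h : n < α.length then α[n]
  else β[(n - α.length) % β.length]'(Nat.mod_lt _ (List.length_pos_iff.mpr hβ))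

namespace NWA

variable {A Q ι : Type*} {S : ι → Type*}

/-- The master and all slaves are deterministic, and the slaves recognize prefix-free languages. -/
def Deterministic (N : NWA A Q ι S) : Prop :=
  N.master.Deterministic ∧ ∀ i, (N.slave i).Deterministic ∧ (N.slave i).PrefixFree

/-- A run on the infinite word `w`: a run of the master and, for each position `p`, a run of the
slave named by the label of the master transition at `p` on the finite word
`w p, …, w (p + len p - 1)`. -/
structure Run (N : NWA A Q ι S) (w : ℕ → A) where
  state : ℕ → Q
  isRun : N.master.IsRun w state
  len : ℕ → ℕ
  slaveState : ∀ p : ℕ, ℕ → S (N.master.label (state p) (w p) (state (p + 1)))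
  slaveIsRun : ∀ p, (N.slave _).IsFinRun (fun j => w (p + j)) (len p) (slaveState p)

namespace Run

variable {N : NWA A Q ι S} {w : ℕ → A}

/-- The master and all slaves accept, and infinitely many slave runs are non-silent, that is,
take at least one step. -/
def Accepting (r : N.Run w) : Prop :=
  N.master.IsBuchiAccepting r.state ∧
    (∀ p, r.slaveState p (r.len p) ∈ (N.slave _).acc) ∧
    ∃ᶠ p in atTop, 0 < r.len p

/-- The weight of step `j` of the slave invoked at position `p`; this step reads the letter at
position `p + j`. -/
def weight (r : N.Run w) (p j : ℕ) : ℤ :=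
  (N.slave _).label (r.slaveState p j) (w (p + j)) (r.slaveState p (j + 1))

/-- The sum of the weights of the slave run that starts at position `p`. -/
def slaveSum (r : N.Run w) (p : ℕ) : ℤ := ∑ j ∈ Finset.range (r.len p), r.weight p j

/-- The position of the non-silent invocation number `i`, counted from `0`. -/
noncomputable def invocation (r : N.Run w) (i : ℕ) : ℕ := Nat.nth (fun p => 0 < r.len p) i

/-- The limit average of the slave values after removal of the silent ones. -/
noncomputable def value (r : N.Run w) : EReal := limAvg fun i => r.slaveSum (r.invocation i)

/-- The slaves, given by their positions of invocation, that are active at position `b`: they are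
invoked at or before `b` and read the letter at `b`. -/
def active (r : N.Run w) (b : ℕ) : Finset ℕ := {p ∈ Finset.range (b + 1) | b < p + r.len p}

/-- The slaves in the configuration that is reached before the letter at `b` is read: they are
invoked strictly before `b` and have not yet terminated. -/
def pending (r : N.Run w) (b : ℕ) : Finset ℕ := {p ∈ Finset.range b | b < p + r.len p}

/-- The sum of the weights that the slaves active at `b` accumulate on the letters from `b` on. -/
def tailSum (r : N.Run w) (b : ℕ) : ℤ :=
  ∑ p ∈ r.active b, ∑ j ∈ Finset.Ico (b - p) (r.len p), r.weight p j

end Run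

/-- The word `w` is accepted. -/
def Accepts (N : NWA A Q ι S) (w : ℕ → A) : Prop := ∃ r : N.Run w, r.Accepting

/-- The value of a word: the infimum over its accepting runs (`⊤` if there is none). -/
noncomputable def value (N : NWA A Q ι S) (w : ℕ → A) : EReal :=
  ⨅ (r : N.Run w) (_ : r.Accepting), r.value

/-- Width `k`: at each position of each accepting run, at most `k` slaves are running. Slaves are
counted as in configurations, so a slave that ends on the letter on which another one starts does
not overlap with it. -/
def HasWidth (N : NWA A Q ι S) (k : ℕ) : Prop :=
  ∀ (w : ℕ → A) (r : N.Run w), r.Accepting → ∀ b, (r.pending b).card ≤ k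

/-- Configurations `(q; q₁, …, q_k)`: a master state and `k` entries, each a state of some slave or
`none`, where the entries `none` come last. -/
def Config (_N : NWA A Q ι S) (k : ℕ) : Type _ :=
  {c : Q × (Fin k → Option (Σ i, S i)) // ∀ i j, i ≤ j → c.2 i = none → c.2 j = none}

/-- The number of configurations. -/
noncomputable def conf (N : NWA A Q ι S) (k : ℕ) : ℕ := Nat.card (N.Config k)

/-- The weights of the transitions of the slaves. -/
def weights (N : NWA A Q ι S) : Set ℤ :=
  {x | ∃ i q a q', (N.slave i).trans q a q' ∧ (N.slave i).label q a q' = x}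

/-- The minimal slave weight `C` is negative, and some accepted word has infinitely many positions
`b` such that the slaves active at `b` accumulate less than `C * k ^ 2 * conf` from `b` on. -/
def ConditionStar (N : NWA A Q ι S) (k : ℕ) : Prop :=
  ∃ C : ℤ, IsLeast N.weights C ∧ C < 0 ∧
    ∃ (w : ℕ → A) (r : N.Run w), r.Accepting ∧
      ∃ᶠ b in atTop, r.tailSum b < C * (k : ℤ) ^ 2 * (N.conf k : ℤ)

/-- A dense word: in its accepting run, the `i`-th (non-silently) invoked slave takes `O(log i)`
steps. As `invocation` counts from `0`, invocation `i` is the `(i + 1)`-st one. -/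
def Dense (N : NWA A Q ι S) (w : ℕ → A) : Prop :=
  ∃ r : N.Run w, r.Accepting ∧
    (fun i : ℕ => (r.len (r.invocation i) : ℝ)) =O[atTop] fun i : ℕ => Real.log ((i : ℝ) + 1)

end NWA

/-!
The values of runs are governed by a finite weighted graph. Since the automaton is deterministic and
its slaves have prefix-free languages, the future of a run is a function of the remaining word and
of the configuration: the master state together with the multiset of the states of the running
slaves. Width `k` leaves finitely many configurations in accepting runs. A step of the
configuration dynamics has a weight (the sum of the weights of the slave steps taken) and a count
(`1` if a non-silent slave is invoked, else `0`).

From condition (*) only this is needed: if it fails, then there is a `K` such that every accepting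
run eventually satisfies `K ≤ tailSum b` (`NWA.exists_tailSum_bound`).

Let `c` be a configuration that some accepting run visits infinitely often. There are a word `α`
leading to `c` and a word `y` from `c` to `c` during which all slaves running in `c` end and the
acceptance conditions make progress (`NWA.Deterministic.exists_isAnchor`). Hence for every closed
walk `z` at `c` and all exponents `m j`, the word `α z^(m 0) y z^(m 1) y …` is accepted
(`NWA.Deterministic.IsPumped.exists_accepting`).

* A closed walk of count `0` has a nonnegative weight; otherwise high powers of it would push
  `tailSum` below `K` infinitely often (`NWA.Deterministic.walkSum_stepWeight_nonneg`).
* Let `μ` be the minimal ratio of weight and count over the finitely many closed walks of positive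
  count that are no longer than the number of recurrent configurations. Then `weight - μ * count` is
  nonnegative on all short closed walks, so it is bounded below along every accepting run, because
  closed parts can be cut out of long walks (`walkSum_ge`). Together with the bound `K` on
  the tails, this gives `μ ≤ value` for every accepting run (`NWA.Deterministic.le_run_value`).
* If `z` attains the minimum, then in the word `α z^(m 0) y z^(m 1) y …` only `α`, the copies of `y`
  and one tail contribute to the difference between the sum of the slave values and `μ` times their
  number (`NWA.Deterministic.exists_pumped_value_bound`). With a large constant `m` the word is a
  lasso word of value close to `μ`. With `m j` of order `log j` its value is exactly `μ`, and it is
  dense as every slave ends within two blocks (`NWA.Deterministic.IsPumped.dense`).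
-/

/-! ### Words and walks of a deterministic system -/

section Walks

variable {V A : Type*}

/-- The states visited from `c` by the system with transition function `nxt` on the infinite
word `w`. -/
def orbit (nxt : V → A → V) (c : V) (w : ℕ → A) : ℕ → V
  | 0 => c
  | t + 1 => nxt (orbit nxt c w t) (w t)

/-- The factor of length `n` of the word `w` that starts at position `s`. -/
def factor (w : ℕ → A) (s n : ℕ) : List A := (List.range' s n).map w

/-- The sum of `f` over the steps of the walk from `c` that reads the word `u`. -/
def walkSum (nxt : V → A → V) (f : V → A → ℝ) : V → List A → ℝ
  | _, [] => 0
  | c, a :: u => f c a + walkSum nxt f (nxt c a) u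

/-- All steps of the walk from `c` that reads the word `u` satisfy `P`. -/
def IsWalk (nxt : V → A → V) (P : V → A → Prop) : V → List A → Prop
  | _, [] => True
  | c, a :: u => P c a ∧ IsWalk nxt P (nxt c a) u

variable {nxt : V → A → V}

@[simp] lemma length_factor (w : ℕ → A) (s n : ℕ) : (factor w s n).length = n := by
  simp [factor]

lemma factor_succ (w : ℕ → A) (s n : ℕ) :
    factor w s (n + 1) = w s :: factor w (s + 1) n := by
  simp [factor, List.range'_succ]

lemma factor_add (w : ℕ → A) (s m n : ℕ) :
    factor w s (m + n) = factor w s m ++ factor w (s + m) n := by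
  simp [factor, ← List.range'_append_1]

lemma take_factor (w : ℕ → A) (s : ℕ) {m n : ℕ} (h : m ≤ n) :
    (factor w s n).take m = factor w s m := by
  obtain ⟨d, rfl⟩ := Nat.exists_eq_add_of_le h
  rw [factor_add, List.take_left' (by simp)]

/-- A factor that reads `u ++ v` splits into one that reads `u` and one that reads `v`. -/
lemma factor_eq_append {w : ℕ → A} {s : ℕ} {u v : List A}
    (h : factor w s (u ++ v).length = u ++ v) :
    factor w s u.length = u ∧ factor w (s + u.length) v.length = v := by
  rw [List.length_append, factor_add] at h
  exact List.append_inj h (by simp)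

lemma orbit_add (c : V) (w : ℕ → A) (s n : ℕ) :
    orbit nxt c w (s + n) = (factor w s n).foldl nxt (orbit nxt c w s) := by
  induction n generalizing s with
  | zero => simp [factor]
  | succ n ih =>
    rw [factor_succ, List.foldl_cons, show s + (n + 1) = s + 1 + n by ring, ih (s + 1)]
    rfl

lemma walkSum_append (f : V → A → ℝ) (c : V) (u v : List A) :
    walkSum nxt f c (u ++ v) = walkSum nxt f c u + walkSum nxt f (u.foldl nxt c) v := by
  induction u generalizing c with
  | nil => simp [walkSum]
  | cons a u ih => simp [walkSum, ih, add_assoc]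

lemma isWalk_append {P : V → A → Prop} {c : V} {u v : List A} :
    IsWalk nxt P c (u ++ v) ↔ IsWalk nxt P c u ∧ IsWalk nxt P (u.foldl nxt c) v := by
  induction u generalizing c with
  | nil => simp [IsWalk]
  | cons a u ih => simp [IsWalk, ih, and_assoc]

lemma IsWalk.mono {P R : V → A → Prop} (h : ∀ c a, P c a → R c a) {c : V} {u : List A}
    (hu : IsWalk nxt P c u) : IsWalk nxt R c u := by
  induction u generalizing c with
  | nil => trivial
  | cons a u ih => exact ⟨h _ _ hu.1, ih hu.2⟩

lemma walkSum_factor (f : V → A → ℝ) (c : V) (w : ℕ → A) (s n : ℕ) :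
    walkSum nxt f (orbit nxt c w s) (factor w s n) =
      ∑ t ∈ Finset.range n, f (orbit nxt c w (s + t)) (w (s + t)) := by
  induction n with
  | zero => simp [factor, walkSum]
  | succ n ih =>
    rw [factor_add, walkSum_append, ih, ← orbit_add, Finset.sum_range_succ]
    simp [factor, walkSum]

lemma isWalk_factor {P : V → A → Prop} {c : V} {w : ℕ → A} {s n : ℕ} :
    IsWalk nxt P (orbit nxt c w s) (factor w s n) ↔
      ∀ t < n, P (orbit nxt c w (s + t)) (w (s + t)) := by
  induction n with
  | zero => simp [factor, IsWalk]
  | succ n ih =>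
    rw [factor_add, isWalk_append, ih, ← orbit_add, Nat.forall_lt_succ_right]
    simp [factor, IsWalk]

lemma walkSum_sub_mul (f g : V → A → ℝ) (μ : ℝ) (c : V) (u : List A) :
    walkSum nxt (fun c a => f c a - μ * g c a) c u = walkSum nxt f c u - μ * walkSum nxt g c u := by
  induction u generalizing c with
  | nil => simp [walkSum]
  | cons a u ih => simp only [walkSum, ih]; ring

lemma walkSum_nonneg {f : V → A → ℝ} (hf : ∀ c a, 0 ≤ f c a) (c : V) (u : List A) :
    0 ≤ walkSum nxt f c u := by
  induction u generalizing c with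
  | nil => simp [walkSum]
  | cons a u ih => exact add_nonneg (hf _ _) (ih _)

lemma walkSum_ge_of_length {P : V → A → Prop} {f : V → A → ℝ} {B : ℝ}
    (hf : ∀ c a, P c a → -B ≤ f c a) {c : V} {u : List A} (hu : IsWalk nxt P c u) :
    -(B * u.length) ≤ walkSum nxt f c u := by
  induction u generalizing c with
  | nil => simp [walkSum]
  | cons a u ih =>
    have h1 := hf _ _ hu.1
    have h2 := ih hu.2
    simp only [walkSum, List.length_cons]
    push_cast
    linarith

lemma foldl_flatten_replicate {c : V} {z : List A} (hz : z.foldl nxt c = c) (n : ℕ) :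
    (List.replicate n z).flatten.foldl nxt c = c := by
  induction n with
  | zero => simp
  | succ n ih => simp [List.replicate_succ, hz, ih]

lemma walkSum_flatten_replicate (f : V → A → ℝ) {c : V} {z : List A} (hz : z.foldl nxt c = c)
    (n : ℕ) : walkSum nxt f c (List.replicate n z).flatten = n * walkSum nxt f c z := by
  induction n with
  | zero => simp [walkSum]
  | succ n ih =>
    rw [List.replicate_succ, List.flatten_cons, walkSum_append, hz, ih]
    push_cast
    ring

lemma isWalk_flatten_replicate {P : V → A → Prop} {c : V} {z : List A}
    (hz : z.foldl nxt c = c) (h : IsWalk nxt P c z) (n : ℕ) :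
    IsWalk nxt P c (List.replicate n z).flatten := by
  induction n with
  | zero => trivial
  | succ n ih =>
    rw [List.replicate_succ, List.flatten_cons, isWalk_append, hz]
    exact ⟨h, ih⟩

/-- If no closed walk that is at most as long as the number of states has a negative sum, then the
sums of all walks are bounded below: closed parts can be cut out of a long walk until a short one
is left. -/
lemma walkSum_ge {P : V → A → Prop} {f : V → A → ℝ} {B : ℝ} (hB : 0 ≤ B) (D : Finset V)
    (hD : ∀ c a, P c a → c ∈ D) (hf : ∀ c a, P c a → -B ≤ f c a)
    (hcyc : ∀ c u, IsWalk nxt P c u → u.foldl nxt c = c → u.length ≤ D.card →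
      0 ≤ walkSum nxt f c u) (c : V) (u : List A) (hu : IsWalk nxt P c u) :
    -(B * D.card) ≤ walkSum nxt f c u := by
  induction hn : u.length using Nat.strong_induction_on generalizing u with
  | _ n ih =>
    subst hn
    rcases le_or_gt u.length D.card with hle | hlt
    · have h1 := walkSum_ge_of_length hf hu
      have h2 : (u.length : ℝ) ≤ D.card := by exact_mod_cast hle
      nlinarith
    · have hmem : ∀ i ∈ Finset.range (D.card + 1), (u.take i).foldl nxt c ∈ D := by
        intro i hi
        have hi' : i < u.length := by
          have := Finset.mem_range.mp hi
          omega
        have h := hu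
        rw [← List.take_append_drop i u, isWalk_append, List.drop_eq_getElem_cons hi'] at h
        exact hD _ _ h.2.1
      obtain ⟨i, hi, j, hj, hne, hij⟩ :=
        Finset.exists_ne_map_eq_of_card_lt_of_maps_to (by simp) hmem
      wlog hlt' : i < j generalizing i j
      · exact this j hj i hi hne.symm hij.symm (by omega)
      have hi' := Finset.mem_range.mp hi
      have hj' := Finset.mem_range.mp hj
      obtain ⟨d, rfl⟩ := Nat.exists_eq_add_of_lt hlt'
      set x := u.take i with hx
      set y := (u.drop i).take (d + 1) with hy
      set v := u.drop (i + d + 1) with hv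
      have huxyv : u = x ++ (y ++ v) := by
        rw [hx, hy, hv, add_assoc, ← List.drop_drop, List.take_append_drop,
          List.take_append_drop]
      have hxy : u.take (i + d + 1) = x ++ y := by
        rw [hx, hy, add_assoc, List.take_add]
      rw [hxy, List.foldl_append] at hij
      have hlen : u.length = x.length + (y.length + v.length) := by
        conv_lhs => rw [huxyv]
        simp
      have hylen : y.length = d + 1 := by
        rw [hy, List.length_take, List.length_drop]
        omega
      rw [huxyv, isWalk_append, isWalk_append, ← hij] at hu
      have h1 : 0 ≤ walkSum nxt f (x.foldl nxt c) y :=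
        hcyc _ _ hu.2.1 hij.symm (by omega)
      have h2 := ih (x ++ v).length (by rw [List.length_append]; omega) (x ++ v)
        (isWalk_append.mpr ⟨hu.1, hu.2.2⟩) rfl
      rw [huxyv, walkSum_append, walkSum_append, ← hij]
      rw [walkSum_append] at h2
      linarith

/-! ### Infinite words composed of finite blocks -/

/-- The position at which block number `j` starts in the word `α (L 0) (L 1) …`. -/
def blockStart (α : List A) (L : ℕ → List A) (j : ℕ) : ℕ :=
  α.length + ∑ i ∈ Finset.range j, (L i).length

lemma blockStart_succ (α : List A) (L : ℕ → List A) (j : ℕ) :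
    blockStart α L (j + 1) = blockStart α L j + (L j).length := by
  simp [blockStart, Finset.sum_range_succ, add_assoc]

lemma le_blockStart {α : List A} {L : ℕ → List A} (hL : ∀ j, L j ≠ []) (j : ℕ) :
    j ≤ blockStart α L j := by
  induction j with
  | zero => simp
  | succ j ih =>
    rw [blockStart_succ]
    have := List.length_pos_iff.mpr (hL j)
    omega

/-- `w` is the word `α (L 0) (L 1) …`. -/
def IsBlockWord (w : ℕ → A) (α : List A) (L : ℕ → List A) : Prop :=
  factor w 0 α.length = α ∧ ∀ j, factor w (blockStart α L j) (L j).length = L j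

lemma exists_isBlockWord (α : List A) (L : ℕ → List A) (hL : ∀ j, L j ≠ []) :
    ∃ w, IsBlockWord w α L := by
  let pre : ℕ → List A := fun n => α ++ ((List.range n).map L).flatten
  have hsucc : ∀ n, pre (n + 1) = pre n ++ L n := fun n => by
    simp [pre, List.range_succ]
  have hlen : ∀ n, (pre n).length = blockStart α L n := fun n => by
    induction n with
    | zero => simp [pre, blockStart]
    | succ n ih => rw [hsucc, List.length_append, ih, blockStart_succ]
  have hmono : ∀ m n, m ≤ n → pre m <+: pre n := fun m n h => by
    induction n, h using Nat.le_induction with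
    | base => exact List.prefix_rfl
    | succ n _ ih => exact ih.trans (hsucc n ▸ List.prefix_append _ _)
  have hlt : ∀ t, t < (pre (t + 1)).length := fun t => by
    rw [hlen]
    exact le_blockStart hL (t + 1)
  let w : ℕ → A := fun t => (pre (t + 1))[t]'(hlt t)
  have hw : ∀ n t (h : t < (pre n).length), w t = (pre n)[t] := fun n t h => by
    rcases le_total n (t + 1) with h' | h'
    · exact ((hmono _ _ h').getElem h).symm
    · exact (hmono _ _ h').getElem (hlt t)
  have hseg : ∀ n, factor w 0 (pre n).length = pre n := fun n => by
    apply List.ext_getElem (by simp)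
    intro t h1 h2
    simp only [factor, List.getElem_map, List.getElem_range', zero_add, one_mul]
    exact hw n t h2
  refine ⟨w, by simpa [pre] using hseg 0, fun j => ?_⟩
  have h := hseg (j + 1)
  rw [hsucc] at h
  have := (factor_eq_append h).2
  rwa [hlen, zero_add] at this

lemma isBlockWord_lasso (α β : List A) (hβ : β ≠ []) :
    IsBlockWord (lasso α β hβ) α (fun _ => β) := by
  constructor
  · apply List.ext_getElem (by simp)
    intro t h1 h2
    simp [factor, lasso, h2]
  · intro j
    apply List.ext_getElem (by simp)
    intro t h1 h2
    simp only [factor, List.getElem_map, List.getElem_range', one_mul, lasso, blockStart,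
      Finset.sum_const, Finset.card_range, smul_eq_mul]
    rw [dif_neg (by omega)]
    congr 1
    rw [show α.length + j * β.length + t - α.length = t + j * β.length by omega,
      Nat.add_mul_mod_self_right, Nat.mod_eq_of_lt h2]

end Walks

/-! ### Limit averages -/

/-- Summation over the first values of a sequence from which the vanishing terms at positions
outside `P` were removed. -/
lemma sum_range_count_nth {M : Type*} [AddCommMonoid M] (P : ℕ → Prop) [DecidablePred P]
    (f : ℕ → M) (hf : ∀ p, ¬ P p → f p = 0) (b : ℕ) :
    ∑ i ∈ Finset.range (Nat.count P b), f (Nat.nth P i) = ∑ p ∈ Finset.range b, f p := by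
  induction b with
  | zero => simp
  | succ b ih =>
    rw [Finset.sum_range_succ, ← ih, Nat.count_succ]
    split_ifs with h
    · rw [Finset.sum_range_succ, Nat.nth_count h]
    · rw [hf b h, add_zero, add_zero]

lemma le_limAvg {x : ℕ → ℤ} {μ C : ℝ}
    (h : ∀ᶠ n : ℕ in atTop, μ * n - C ≤ ∑ i ∈ Finset.range n, (x i : ℝ)) :
    (μ : EReal) ≤ limAvg x := by
  have hlim : Tendsto (fun n : ℕ => ((μ - C / n : ℝ) : EReal)) atTop (nhds (μ : EReal)) := by
    refine (continuous_coe_real_ereal.tendsto μ).comp ?_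
    simpa using tendsto_const_nhds.sub (tendsto_const_div_atTop_nhds_zero_nat C)
  rw [← hlim.liminf_eq]
  refine liminf_le_liminf ?_
  filter_upwards [h, eventually_gt_atTop 0] with n hn hpos
  rw [EReal.coe_le_coe_iff]
  have : (0 : ℝ) < n := by exact_mod_cast hpos
  rw [le_div_iff₀ this, sub_mul, div_mul_cancel₀ _ this.ne']
  exact hn

lemma limAvg_le {x : ℕ → ℤ} {μ : ℝ}
    (h : ∃ᶠ n : ℕ in atTop, ∑ i ∈ Finset.range n, (x i : ℝ) ≤ μ * n) :
    limAvg x ≤ (μ : EReal) := by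
  refine liminf_le_of_frequently_le' ?_
  refine (h.and_eventually (eventually_gt_atTop 0)).mono fun n hn => ?_
  have : (0 : ℝ) < n := by exact_mod_cast hn.2
  rw [EReal.coe_le_coe_iff, div_le_iff₀ this]
  exact hn.1

/-! ### The configuration dynamics of a deterministic nested automaton -/

namespace LabeledAutomaton

variable {A Q X : Type*}

open Classical in
/-- The successor of `q` under the letter `a`, and `q` itself if there is none. -/
noncomputable def next (M : LabeledAutomaton A Q X) (q : Q) (a : A) : Q :=
  if h : ∃ q', M.trans q a q' then h.choose else q

lemma Deterministic.next_eq {M : LabeledAutomaton A Q X} (h : M.Deterministic) {q q' : Q} {a : A}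
    (ht : M.trans q a q') : M.next q a = q' := by
  have hex : ∃ q', M.trans q a q' := ⟨q', ht⟩
  rw [next, dif_pos hex]
  exact h.2 _ _ _ _ hex.choose_spec ht

/-- The initial state of a deterministic automaton. -/
noncomputable def Deterministic.start {M : LabeledAutomaton A Q X} (h : M.Deterministic) : Q :=
  h.1.choose

lemma Deterministic.mem_init {M : LabeledAutomaton A Q X} (h : M.Deterministic) {q : Q} :
    q ∈ M.init ↔ q = h.start := by
  conv_lhs => rw [h.1.choose_spec]
  exact Set.mem_singleton_iff

lemma Deterministic.finRun_eq {M : LabeledAutomaton A Q X} (h : M.Deterministic) {u : ℕ → A}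
    {n : ℕ} {π : ℕ → Q} (hπ : M.IsFinRun u n π) {j : ℕ} (hj : j ≤ n) :
    π j = orbit M.next h.start u j := by
  induction j with
  | zero => exact h.mem_init.mp hπ.1
  | succ j ih =>
    rw [orbit, ← ih (by omega)]
    exact (h.next_eq (hπ.2 j hj)).symm

/-- A run of an automaton with a prefix-free language is over as soon as it visits an accepting
state. -/
lemma PrefixFree.notMem_acc_of_lt {M : LabeledAutomaton A Q X} (h : M.PrefixFree) {u : ℕ → A}
    {n : ℕ} {π : ℕ → Q} (hπ : M.IsFinRun u n π) (hn : π n ∈ M.acc) {j : ℕ} (hj : j < n) :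
    π j ∉ M.acc := by
  intro hacc
  have key : ∀ m ≤ n, π m ∈ M.acc → M.AcceptsFin (factor u 0 m) := fun m hm hm' =>
    ⟨π, hπ.1, fun i hi => by
      rw [length_factor] at hi
      simpa [factor] using hπ.2 i (by omega), by simpa using hm'⟩
  have h1 := key n le_rfl hn
  obtain ⟨d, rfl⟩ := Nat.exists_eq_add_of_le hj.le
  rw [factor_add] at h1
  have h2 := congrArg List.length (h _ _ (key j hj.le hacc) h1)
  rw [length_factor, List.length_nil] at h2
  omega

end LabeledAutomaton

namespace NWA

variable {A Q ι : Type*} {S : ι → Type*} {N : NWA A Q ι S}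

/-- The slave states in which a slave run is over. -/
def final (N : NWA A Q ι S) : Set (Σ i, S i) := {s | s.2 ∈ (N.slave s.1).acc}

/-- The successor of a slave state. -/
noncomputable def slaveNext (N : NWA A Q ι S) (s : Σ i, S i) (a : A) : Σ i, S i :=
  ⟨s.1, (N.slave s.1).next s.2 a⟩

/-- The weight of the step that a slave takes from the state `s` under the letter `a`. -/
noncomputable def slaveWeight (N : NWA A Q ι S) (s : Σ i, S i) (a : A) : ℤ :=
  (N.slave s.1).label s.2 a ((N.slave s.1).next s.2 a)

/-- There is a transition from the slave state `s` under the letter `a`. -/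
def SlaveOk (N : NWA A Q ι S) (s : Σ i, S i) (a : A) : Prop :=
  (N.slave s.1).trans s.2 a ((N.slave s.1).next s.2 a)

namespace Deterministic

variable (hd : N.Deterministic)

/-- The initial state of the slave that is invoked when the master in state `q` reads `a`. -/
noncomputable def invoked (q : Q) (a : A) : Σ i, S i :=
  ⟨N.master.label q a (N.master.next q a), (hd.2 _).1.start⟩

open Classical in
/-- The states of the slaves that read the letter `a` in the configuration `c`. Configurations
are represented by the master state and the multiset of the states of the running slaves; the order
of the slaves in a configuration plays no role in the argument. -/
noncomputable def running (c : Q × Multiset (Σ i, S i)) (a : A) : Multiset (Σ i, S i) :=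
  c.2 + if hd.invoked c.1 a ∈ N.final then 0 else {hd.invoked c.1 a}

open Classical in
/-- The configuration that is reached from `c` under the letter `a`. -/
noncomputable def step (c : Q × Multiset (Σ i, S i)) (a : A) : Q × Multiset (Σ i, S i) :=
  (N.master.next c.1 a, ((hd.running c a).map (N.slaveNext · a)).filter (· ∉ N.final))

/-- The master and all running slaves have a transition under the letter `a`. -/
def Ok (c : Q × Multiset (Σ i, S i)) (a : A) : Prop :=
  N.master.trans c.1 a (N.master.next c.1 a) ∧ ∀ s ∈ hd.running c a, N.SlaveOk s a

/-- The sum of the weights of the steps that the running slaves take under the letter `a`. -/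
noncomputable def stepWeight (c : Q × Multiset (Σ i, S i)) (a : A) : ℝ :=
  (((hd.running c a).map (N.slaveWeight · a)).sum : ℤ)

open Classical in
/-- The number (`0` or `1`) of non-silent slaves invoked by the master in `c` under `a`. -/
noncomputable def stepCount (c : Q × Multiset (Σ i, S i)) (a : A) : ℝ :=
  if hd.invoked c.1 a ∈ N.final then 0 else 1

lemma stepCount_nonneg (c : Q × Multiset (Σ i, S i)) (a : A) : 0 ≤ hd.stepCount c a := by
  unfold stepCount
  split_ifs <;> norm_num

lemma stepCount_le_one (c : Q × Multiset (Σ i, S i)) (a : A) : hd.stepCount c a ≤ 1 := by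
  unfold stepCount
  split_ifs <;> norm_num

/-- The configuration before the first letter is read. -/
noncomputable def initial : Q × Multiset (Σ i, S i) := (hd.1.start, 0)

/-- The sequence of the configurations on the word `w`. -/
noncomputable def path (w : ℕ → A) : ℕ → Q × Multiset (Σ i, S i) :=
  orbit hd.step hd.initial w

lemma path_succ (w : ℕ → A) (t : ℕ) : hd.path w (t + 1) = hd.step (hd.path w t) (w t) := rfl

/-- The index of the slave that is invoked at position `p`. -/
noncomputable def index (w : ℕ → A) (p : ℕ) : ι :=
  N.master.label (hd.path w p).1 (w p) (hd.path w (p + 1)).1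

/-- The state of the slave invoked at position `p` after `j` steps. This is defined for all `j`,
also after the end of the slave run. -/
noncomputable def slaveAt (w : ℕ → A) (p j : ℕ) : Σ i, S i :=
  ⟨hd.index w p, orbit (N.slave (hd.index w p)).next (hd.2 (hd.index w p)).1.start
    (fun j => w (p + j)) j⟩

lemma slaveAt_zero (w : ℕ → A) (p : ℕ) :
    hd.slaveAt w p 0 = hd.invoked (hd.path w p).1 (w p) := rfl

lemma slaveAt_succ (w : ℕ → A) (p j : ℕ) :
    hd.slaveAt w p (j + 1) = N.slaveNext (hd.slaveAt w p j) (w (p + j)) := rfl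

lemma slaveAt_add (w : ℕ → A) (p j i : ℕ) :
    hd.slaveAt w p (j + i) = (factor w (p + j) i).foldl N.slaveNext (hd.slaveAt w p j) := by
  induction i with
  | zero => simp [factor]
  | succ i ih =>
    rw [factor_add, List.foldl_append, ← ih, ← add_assoc, slaveAt_succ]
    simp [factor, add_assoc]

open Classical in
/-- The slaves that are invoked before position `b` and did not end before or at `b`. -/
noncomputable def alive (w : ℕ → A) (b : ℕ) : Finset ℕ :=
  {p ∈ Finset.range b | ∀ j ≤ b - p, hd.slaveAt w p j ∉ N.final}

open Classical in
/-- The slaves that read the letter at position `b`. -/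
noncomputable def reading (w : ℕ → A) (b : ℕ) : Finset ℕ :=
  {p ∈ Finset.range (b + 1) | ∀ j ≤ b - p, hd.slaveAt w p j ∉ N.final}

lemma running_eq_of_path_eq {w : ℕ → A} {b : ℕ}
    (h : (hd.path w b).2 = (hd.alive w b).val.map fun p => hd.slaveAt w p (b - p)) :
    hd.running (hd.path w b) (w b) =
      (hd.reading w b).val.map fun p => hd.slaveAt w p (b - p) := by
  classical
  rw [running, h, ← slaveAt_zero]
  have hr : hd.reading w b =
      if hd.slaveAt w b 0 ∈ N.final then hd.alive w b else insert b (hd.alive w b) := by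
    rw [reading, Finset.range_add_one, Finset.filter_insert]
    simp only [Nat.sub_self, Nat.le_zero, forall_eq, alive]
    split_ifs <;> rfl
  rw [hr]
  split_ifs with hfin
  · simp
  · rw [Finset.insert_val_of_notMem (by simp [alive]), Multiset.map_cons]
    simp [add_comm, Multiset.singleton_add]

/-- The configuration at position `b` lists the states of the slaves that are running there. -/
lemma path_snd (w : ℕ → A) (b : ℕ) :
    (hd.path w b).2 = (hd.alive w b).val.map fun p => hd.slaveAt w p (b - p) := by
  classical
  induction b with
  | zero => simp [path, orbit, alive, initial]
  | succ b ih =>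
    rw [path_succ, step, hd.running_eq_of_path_eq ih, Multiset.map_map, Multiset.filter_map]
    have h1 : (hd.alive w (b + 1)).val =
        Multiset.filter (fun p => hd.slaveAt w p (b + 1 - p) ∉ N.final) (hd.reading w b).val := by
      rw [← Finset.filter_val, reading, Finset.filter_filter, alive]
      congr 1
      apply Finset.filter_congr
      intro p hp
      have hp' : p ≤ b := Nat.lt_succ_iff.mp (Finset.mem_range.mp hp)
      rw [Nat.succ_sub hp']
      constructor
      · exact fun h => ⟨fun j hj => h j (by omega), h _ le_rfl⟩
      · intro h j hj
        rcases Nat.le_succ_iff.mp hj with hj' | rfl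
        · exact h.1 j hj'
        · exact h.2
    rw [h1]
    have h2 : ∀ p ∈ (hd.reading w b).val,
        N.slaveNext (hd.slaveAt w p (b - p)) (w b) = hd.slaveAt w p (b + 1 - p) := by
      intro p hp
      have hp' : p ≤ b := by
        have := (Finset.mem_filter.mp (Finset.mem_val.mp hp)).1
        exact Nat.lt_succ_iff.mp (Finset.mem_range.mp this)
      rw [Nat.succ_sub hp', slaveAt_succ, Nat.add_sub_cancel' hp']
    have h3 : Multiset.filter ((fun s => s ∉ N.final) ∘
          ((fun s => N.slaveNext s (w b)) ∘ fun p => hd.slaveAt w p (b - p)))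
          (hd.reading w b).val =
        Multiset.filter (fun p => hd.slaveAt w p (b + 1 - p) ∉ N.final) (hd.reading w b).val := by
      apply Multiset.filter_congr
      intro p hp
      simp only [Function.comp, h2 p hp]
    rw [h3]
    dsimp only
    refine Multiset.map_congr rfl fun p hp => ?_
    exact h2 p (Multiset.mem_filter.mp hp).1

lemma running_path (w : ℕ → A) (b : ℕ) :
    hd.running (hd.path w b) (w b) =
      (hd.reading w b).val.map fun p => hd.slaveAt w p (b - p) :=
  hd.running_eq_of_path_eq (hd.path_snd w b)

lemma mem_path_snd {w : ℕ → A} {b p : ℕ} (hp : p < b)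
    (h : ∀ j ≤ b - p, hd.slaveAt w p j ∉ N.final) :
    hd.slaveAt w p (b - p) ∈ (hd.path w b).2 := by
  rw [path_snd]
  exact Multiset.mem_map.mpr ⟨p, by simpa [alive] using ⟨hp, h⟩, rfl⟩

lemma mem_running_path {w : ℕ → A} {b p : ℕ} (hp : p ≤ b)
    (h : ∀ j ≤ b - p, hd.slaveAt w p j ∉ N.final) :
    hd.slaveAt w p (b - p) ∈ hd.running (hd.path w b) (w b) := by
  classical
  rw [running_path]
  exact Multiset.mem_map.mpr ⟨p, by
    rw [Finset.mem_val, reading, Finset.mem_filter, Finset.mem_range]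
    exact ⟨Nat.lt_succ_of_le hp, h⟩, rfl⟩

/-! ### Accepting runs follow the configuration dynamics -/

/-- What is known about a run that follows the dynamics: the master state is that of the path, and
the slave invoked at `p` moves through the states `slaveAt w p` until it first visits a final
state. -/
structure Follows {w : ℕ → A} (r : N.Run w) : Prop where
  state_eq : ∀ t, r.state t = (hd.path w t).1
  trans_next : ∀ t, N.master.trans (hd.path w t).1 (w t) (hd.path w (t + 1)).1
  notMem_final : ∀ p, ∀ j < r.len p, hd.slaveAt w p j ∉ N.final
  mem_final : ∀ p, hd.slaveAt w p (r.len p) ∈ N.final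
  weight_eq : ∀ p, ∀ j < r.len p, r.weight p j = N.slaveWeight (hd.slaveAt w p j) (w (p + j))
  slaveOk : ∀ p, ∀ j < r.len p, N.SlaveOk (hd.slaveAt w p j) (w (p + j))

theorem follows {w : ℕ → A} (r : N.Run w) (hr : r.Accepting) : hd.Follows r := by
  have hstate : r.state = fun t => (hd.path w t).1 := by
    funext t
    induction t with
    | zero => exact hd.1.mem_init.mp r.isRun.1
    | succ t ih =>
      rw [path_succ, ← hd.1.next_eq (r.isRun.2 t), ih]
      rfl
  obtain ⟨state, isRun, len, slaveState, slaveIsRun⟩ := r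
  dsimp only at hstate
  subst hstate
  have hs : ∀ p j, j ≤ len p → slaveState p j = (hd.slaveAt w p j).2 := fun p j hj =>
    (hd.2 (hd.index w p)).1.finRun_eq (slaveIsRun p) hj
  have hnext : ∀ p j, j < len p →
      (N.slave (hd.index w p)).next (hd.slaveAt w p j).2 (w (p + j)) = slaveState p (j + 1) :=
    fun p j hj => by
      rw [← hs p j hj.le]
      exact (hd.2 (hd.index w p)).1.next_eq ((slaveIsRun p).2 j hj)
  refine ⟨fun t => rfl, isRun.2, fun p j hj => ?_, fun p => ?_, fun p j hj => ?_, fun p j hj => ?_⟩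
  · have := (hd.2 (hd.index w p)).2.notMem_acc_of_lt (slaveIsRun p) (hr.2.1 p) hj
    rw [hs p j hj.le] at this
    exact this
  · have := hr.2.1 p
    dsimp only at this
    rw [hs p _ le_rfl] at this
    exact this
  · change (N.slave (hd.index w p)).label (slaveState p j) (w (p + j)) (slaveState p (j + 1)) =
      (N.slave (hd.index w p)).label (hd.slaveAt w p j).2 (w (p + j)) _
    rw [hs p j hj.le]
    congr 1
    exact (hnext p j hj).symm
  · change (N.slave (hd.index w p)).trans (hd.slaveAt w p j).2 (w (p + j)) _
    rw [← hs p j hj.le]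
    have h1 : (N.slave (hd.index w p)).trans (slaveState p j) (w (p + j)) (slaveState p (j + 1)) :=
      (slaveIsRun p).2 j hj
    rw [← hnext p j hj, ← hs p j hj.le] at h1
    exact h1

namespace Follows

variable {hd} {w : ℕ → A} {r : N.Run w} (hf : hd.Follows r)
include hf

lemma lt_len_iff (p m : ℕ) : m < r.len p ↔ ∀ j ≤ m, hd.slaveAt w p j ∉ N.final := by
  constructor
  · intro h j hj
    exact hf.notMem_final p j (by omega)
  · intro h
    by_contra! hle
    exact h _ hle (hf.mem_final p)

lemma active_eq (b : ℕ) : r.active b = hd.reading w b := by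
  ext p
  simp only [Run.active, reading, Finset.mem_filter, Finset.mem_range, ← hf.lt_len_iff]
  omega

lemma pending_eq (b : ℕ) : r.pending b = hd.alive w b := by
  ext p
  simp only [Run.pending, alive, Finset.mem_filter, Finset.mem_range, ← hf.lt_len_iff]
  omega

lemma card_path_snd (b : ℕ) : Multiset.card (hd.path w b).2 = (r.pending b).card := by
  rw [path_snd, Multiset.card_map, hf.pending_eq]
  rfl

lemma ok (t : ℕ) : hd.Ok (hd.path w t) (w t) := by
  refine ⟨hf.trans_next t, fun s hs => ?_⟩
  rw [running_path, ← hf.active_eq] at hs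
  obtain ⟨p, hp, rfl⟩ := Multiset.mem_map.mp hs
  have hp' : p < t + 1 ∧ t < p + r.len p := by
      simpa only [Run.active, Finset.mem_val, Finset.mem_filter, Finset.mem_range] using hp
  have := hf.slaveOk p (t - p) (by omega)
  rwa [Nat.add_sub_cancel' (by omega)] at this

lemma stepWeight_eq (t : ℕ) :
    hd.stepWeight (hd.path w t) (w t) = ∑ p ∈ r.active t, (r.weight p (t - p) : ℝ) := by
  rw [stepWeight, running_path, ← hf.active_eq, Multiset.map_map]
  have : (Multiset.map ((fun s => N.slaveWeight s (w t)) ∘ fun p => hd.slaveAt w p (t - p))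
      (r.active t).val).sum = ∑ p ∈ r.active t, r.weight p (t - p) := by
    apply Finset.sum_congr rfl
    intro p hp
    have hp' : p < t + 1 ∧ t < p + r.len p := by
      simpa only [Run.active, Finset.mem_val, Finset.mem_filter, Finset.mem_range] using hp
    rw [hf.weight_eq p _ (by omega), Nat.add_sub_cancel' (by omega)]
    rfl
  rw [this]
  push_cast
  rfl

lemma len_pos_iff (p : ℕ) : 0 < r.len p ↔ hd.invoked (hd.path w p).1 (w p) ∉ N.final := by
  rw [hf.lt_len_iff]
  simp [slaveAt_zero]

lemma stepCount_eq (p : ℕ) :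
    hd.stepCount (hd.path w p) (w p) = if 0 < r.len p then 1 else 0 := by
  unfold stepCount
  by_cases h : hd.invoked (hd.path w p).1 (w p) ∈ N.final <;> simp [hf.len_pos_iff p, h]

end Follows

/-- A word is accepted if its configurations follow the transitions, an accepting master state
recurs, all slaves end and infinitely many non-silent slaves are invoked. -/
theorem exists_accepting {w : ℕ → A} (hok : ∀ t, hd.Ok (hd.path w t) (w t))
    (hacc : ∃ q ∈ N.master.acc, ∃ᶠ t in atTop, (hd.path w t).1 = q)
    (hend : ∀ p, ∃ j, hd.slaveAt w p j ∈ N.final)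
    (hinf : ∃ᶠ t in atTop, hd.invoked (hd.path w t).1 (w t) ∉ N.final) :
    ∃ r : N.Run w, r.Accepting := by
  classical
  let r : N.Run w :=
    { state := fun t => (hd.path w t).1
      isRun := ⟨hd.1.mem_init.mpr rfl, fun t => (hok t).1⟩
      len := fun p => Nat.find (hend p)
      slaveState := fun p j => (hd.slaveAt w p j).2
      slaveIsRun := fun p => ⟨(hd.2 (hd.index w p)).1.mem_init.mpr rfl, fun j hj => by
        have h1 : hd.slaveAt w p (p + j - p) ∈
            hd.running (hd.path w (p + j)) (w (p + j)) := by
          refine hd.mem_running_path (by omega) fun i hi => Nat.find_min (hend p) ?_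
          omega
        rw [Nat.add_sub_cancel_left] at h1
        exact (hok (p + j)).2 _ h1⟩ }
  refine ⟨r, hacc, fun p => Nat.find_spec (hend p), hinf.mono fun p hp => ?_⟩
  exact (Nat.find_pos (hend p)).mpr hp

end Deterministic

end NWA

/-! ### Sums of slave values along a run -/

namespace NWA

variable {A Q ι : Type*} {S : ι → Type*} {N : NWA A Q ι S}

namespace Run

variable {w : ℕ → A} (r : N.Run w)

/-- The sum of the weights that the slaves invoked before `b` accumulate from `b` on. In contrast
to `tailSum`, a slave invoked at `b` does not count. -/
def pendingSum (b : ℕ) : ℤ :=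
  ∑ p ∈ r.pending b, ∑ j ∈ Finset.Ico (b - p) (r.len p), r.weight p j

lemma tailSum_eq_slaveSum_add (b : ℕ) : r.tailSum b = r.slaveSum b + r.pendingSum b := by
  unfold tailSum active
  rw [Finset.range_add_one, Finset.filter_insert]
  split_ifs with h
  · rw [Finset.sum_insert (by simp), Nat.sub_self, ← Finset.range_eq_Ico]
    rfl
  · have : r.len b = 0 := by omega
    simp [slaveSum, this, pendingSum, pending]

lemma tailSum_eq_add_pendingSum (b : ℕ) :
    r.tailSum b = ∑ p ∈ r.active b, r.weight p (b - p) + r.pendingSum (b + 1) := by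
  have h1 : r.pendingSum (b + 1) =
      ∑ p ∈ r.active b, ∑ j ∈ Finset.Ico (b + 1 - p) (r.len p), r.weight p j := by
    unfold pendingSum
    apply Finset.sum_subset
    · intro p hp
      simp only [pending, active, Finset.mem_filter, Finset.mem_range] at hp ⊢
      omega
    · intro p hp hp'
      simp only [pending, active, Finset.mem_filter, Finset.mem_range] at hp hp'
      rw [Finset.Ico_eq_empty (by omega), Finset.sum_empty]
  rw [h1, ← Finset.sum_add_distrib]
  apply Finset.sum_congr rfl
  intro p hp
  simp only [active, Finset.mem_filter, Finset.mem_range] at hp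
  rw [Finset.sum_eq_sum_Ico_succ_bot (by omega), show b - p + 1 = b + 1 - p by omega]

/-- The values of the slaves invoked before `b` consist of the weights collected before `b` and
of those that the pending slaves still collect. -/
lemma sum_slaveSum (b : ℕ) :
    ∑ p ∈ Finset.range b, r.slaveSum p =
      ∑ t ∈ Finset.range b, ∑ p ∈ r.active t, r.weight p (t - p) + r.pendingSum b := by
  induction b with
  | zero => simp [pendingSum, pending]
  | succ b ih =>
    rw [Finset.sum_range_succ, Finset.sum_range_succ, ih]
    have h1 := r.tailSum_eq_slaveSum_add b
    have h2 := r.tailSum_eq_add_pendingSum b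
    linarith

lemma pendingSum_le {b n : ℕ} {B : ℝ} (hB : 0 ≤ B)
    (hn : ∀ p ∈ r.pending b, p + r.len p ≤ b + n)
    (hw : ∀ p, ∀ j < r.len p, (r.weight p j : ℝ) ≤ B) :
    (r.pendingSum b : ℝ) ≤ (r.pending b).card * (n * B) := by
  rw [← nsmul_eq_mul]
  unfold pendingSum
  push_cast
  refine Finset.sum_le_card_nsmul _ _ _ fun p hp => ?_
  have h1 : ∑ j ∈ Finset.Ico (b - p) (r.len p), (r.weight p j : ℝ) ≤
      (Finset.Ico (b - p) (r.len p)).card • B :=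
    Finset.sum_le_card_nsmul _ _ _ fun j hj => hw p j (Finset.mem_Ico.mp hj).2
  refine h1.trans ?_
  rw [nsmul_eq_mul, Nat.card_Ico]
  refine mul_le_mul_of_nonneg_right ?_ hB
  have := hn p hp
  have hp' := Finset.mem_range.mp (Finset.mem_filter.mp hp).1
  exact_mod_cast (by omega : r.len p - (b - p) ≤ n)

end Run

namespace Deterministic.Follows

variable {hd : N.Deterministic} {w : ℕ → A} {r : N.Run w}

lemma sum_slaveSum_eq (hf : hd.Follows r) (b : ℕ) :
    ∑ p ∈ Finset.range b, (r.slaveSum p : ℝ) =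
      ∑ t ∈ Finset.range b, hd.stepWeight (hd.path w t) (w t) + r.pendingSum b := by
  have h := congrArg (fun x : ℤ => (x : ℝ)) (r.sum_slaveSum b)
  push_cast at h
  rw [h]
  congr 1
  exact Finset.sum_congr rfl fun t _ => (hf.stepWeight_eq t).symm

lemma count_eq (hf : hd.Follows r) (b : ℕ) :
    (Nat.count (fun p => 0 < r.len p) b : ℝ) =
      ∑ t ∈ Finset.range b, hd.stepCount (hd.path w t) (w t) := by
  induction b with
  | zero => simp
  | succ b ih =>
    rw [Nat.count_succ, Finset.sum_range_succ, ← ih, hf.stepCount_eq]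
    push_cast
    rfl

end Deterministic.Follows

/-- The values of the non-silent slaves among those invoked before `b`. -/
lemma Run.sum_invocation {w : ℕ → A} (r : N.Run w) (b : ℕ) :
    ∑ i ∈ Finset.range (Nat.count (fun p => 0 < r.len p) b),
        (r.slaveSum (r.invocation i) : ℝ) = ∑ p ∈ Finset.range b, (r.slaveSum p : ℝ) := by
  refine sum_range_count_nth (fun p => 0 < r.len p) (fun p => (r.slaveSum p : ℝ)) ?_ b
  intro p hp
  have : r.len p = 0 := by omega
  simp [Run.slaveSum, this]

/-! ### Uniform bounds -/

section Bounds

variable [Finite A] [Finite ι] [∀ i, Finite (S i)]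

lemma exists_slaveWeight_bound (N : NWA A Q ι S) :
    ∃ B : ℝ, 0 ≤ B ∧ ∀ s a, |(N.slaveWeight s a : ℝ)| ≤ B := by
  obtain ⟨B, hB⟩ := (Set.finite_range
    fun x : (Σ i, S i) × A => |(N.slaveWeight x.1 x.2 : ℝ)|).bddAbove
  exact ⟨max B 0, le_max_right _ _, fun s a => (hB ⟨(s, a), rfl⟩).trans (le_max_left _ _)⟩

/-- If condition (*) fails, then the sums of the weights that active slaves still accumulate are
eventually bounded below, and the bound depends on the automaton only. -/
lemma exists_tailSum_bound {k : ℕ} (hd : N.Deterministic) (hstar : ¬ N.ConditionStar k) :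
    ∃ K : ℝ, ∀ (w : ℕ → A) (r : N.Run w), r.Accepting → ∀ᶠ b in atTop, K ≤ r.tailSum b := by
  have hfin : N.weights.Finite := by
    refine (Set.finite_range fun x : (Σ i, S i × S i) × A =>
      (N.slave x.1.1).label x.1.2.1 x.2 x.1.2.2).subset ?_
    rintro x ⟨i, q, a, q', -, rfl⟩
    exact ⟨(⟨i, q, q'⟩, a), rfl⟩
  rcases N.weights.eq_empty_or_nonempty with hempty | hne
  · -- Without slave transitions no slave takes a step, and no word is accepted.
    refine ⟨0, fun w r hr => ?_⟩
    obtain ⟨p, hp⟩ := hr.2.2.exists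
    have hok := (hd.follows r hr).slaveOk p 0 hp
    exact absurd ⟨_, _, _, _, hok, rfl⟩ (Set.eq_empty_iff_forall_notMem.mp hempty _)
  · obtain ⟨C, hC, hmin⟩ := Set.exists_min_image N.weights id hfin hne
    rcases lt_or_ge C 0 with hneg | hpos
    · refine ⟨((C * (k : ℤ) ^ 2 * (N.conf k : ℤ) : ℤ) : ℝ), fun w r hr => ?_⟩
      by_contra hcon
      refine hstar ⟨C, ⟨hC, hmin⟩, hneg, w, r, hr, ?_⟩
      refine (not_eventually.mp hcon).mono fun b hb => ?_
      exact_mod_cast not_le.mp hb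
    · refine ⟨0, fun w r hr => Eventually.of_forall fun b => ?_⟩
      have hf := hd.follows r hr
      have : 0 ≤ r.tailSum b := by
        refine Finset.sum_nonneg fun p _ => Finset.sum_nonneg fun j hj => ?_
        have hj' := (Finset.mem_Ico.mp hj).2
        rw [hf.weight_eq p j hj']
        exact hpos.trans (hmin _ ⟨_, _, _, _, hf.slaveOk p j hj', rfl⟩)
      exact_mod_cast this

end Bounds

/-! ### Recurrent configurations -/

namespace Deterministic

variable (hd : N.Deterministic)

/-- The configurations that some accepting run visits infinitely often. -/
def recurrent : Set (Q × Multiset (Σ i, S i)) :=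
  {c | ∃ (w : ℕ → A) (r : N.Run w), r.Accepting ∧ ∃ᶠ t in atTop, hd.path w t = c}

variable {hd}

lemma card_path_snd_le {k : ℕ} (hwidth : N.HasWidth k) {w : ℕ → A} {r : N.Run w}
    (hr : r.Accepting) (t : ℕ) : Multiset.card (hd.path w t).2 ≤ k := by
  rw [(hd.follows r hr).card_path_snd]
  exact hwidth w r hr t

lemma card_snd_le_of_mem_recurrent {k : ℕ} (hwidth : N.HasWidth k)
    {c : Q × Multiset (Σ i, S i)} (hc : c ∈ hd.recurrent) : Multiset.card c.2 ≤ k := by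
  obtain ⟨w, r, hr, hrec⟩ := hc
  obtain ⟨t, rfl⟩ := hrec.exists
  exact card_path_snd_le hwidth hr t

lemma abs_stepWeight_le {B : ℝ} (hB : ∀ s a, |(N.slaveWeight s a : ℝ)| ≤ B) (hB0 : 0 ≤ B) {k : ℕ}
    {c : Q × Multiset (Σ i, S i)} (hc : Multiset.card c.2 ≤ k) (a : A) :
    |hd.stepWeight c a| ≤ (k + 1) * B := by
  have hcard : Multiset.card (hd.running c a) ≤ k + 1 := by
    unfold running
    rw [Multiset.card_add]
    split_ifs <;> simp <;> omega
  have key : ∀ m : Multiset (Σ i, S i),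
      |(((m.map (N.slaveWeight · a)).sum : ℤ) : ℝ)| ≤ Multiset.card m * B := by
    intro m
    induction m using Multiset.induction_on with
    | empty => simp
    | cons s m ih =>
      rw [Multiset.map_cons, Multiset.sum_cons, Multiset.card_cons, Int.cast_add, Nat.cast_add,
        Nat.cast_one]
      refine (abs_add_le _ _).trans ?_
      have := hB s a
      linarith
  refine (key _).trans (mul_le_mul_of_nonneg_right ?_ hB0)
  exact_mod_cast hcard

variable [Finite Q] [Finite ι] [∀ i, Finite (S i)]

lemma finite_card_snd_le (k : ℕ) :
    {c : Q × Multiset (Σ i, S i) | Multiset.card c.2 ≤ k}.Finite := by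
  have h1 : {m : Multiset (Σ i, S i) | Multiset.card m ≤ k}.Finite := by
    refine (Set.Finite.image (Multiset.ofList (α := Σ i, S i))
      (List.finite_length_le (Σ i, S i) k)).subset ?_
    intro m hm
    refine ⟨m.toList, ?_, Multiset.coe_toList m⟩
    simpa using hm
  exact (Set.finite_univ.prod h1).subset fun c hc => ⟨Set.mem_univ _, hc⟩

lemma finite_recurrent {k : ℕ} (hwidth : N.HasWidth k) : hd.recurrent.Finite :=
  (finite_card_snd_le k).subset fun _ hc => card_snd_le_of_mem_recurrent hwidth hc

lemma eventually_mem_recurrent {k : ℕ} (hwidth : N.HasWidth k) {w : ℕ → A} {r : N.Run w}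
    (hr : r.Accepting) : ∀ᶠ t in atTop, hd.path w t ∈ hd.recurrent := by
  have h : ∀ c ∈ {c : Q × Multiset (Σ i, S i) | Multiset.card c.2 ≤ k}, ∀ᶠ t in atTop,
      hd.path w t = c → c ∈ hd.recurrent := by
    intro c _
    by_cases hc : c ∈ hd.recurrent
    · exact Eventually.of_forall fun _ _ => hc
    · have : ¬ ∃ᶠ t in atTop, hd.path w t = c := fun h => hc ⟨w, r, hr, h⟩
      filter_upwards [not_frequently.mp this] with t ht ht'
      exact absurd ht' ht
  filter_upwards [(eventually_all_finite (finite_card_snd_le k)).mpr h] with t ht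
  exact ht _ (card_path_snd_le hwidth hr t) rfl

end Deterministic

end NWA

/-! ### Pumping closed walks at recurrent configurations -/

namespace NWA

variable {A Q ι : Type*} {S : ι → Type*} {N : NWA A Q ι S}

namespace Deterministic

/-- The word `α` leads to the configuration `c`, and `y` leads from `c` back to `c` in such a way
that repeating it forever makes an accepting run: it visits an accepting master state, invokes
a non-silent slave, and every slave running in `c` ends while `y` is read. -/
structure IsAnchor (hd : N.Deterministic) (c : Q × Multiset (Σ i, S i)) (α y : List A) :
    Prop where
  start_foldl : α.foldl hd.step hd.initial = c
  start_isWalk : IsWalk hd.step hd.Ok hd.initial α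
  foldl_eq : y.foldl hd.step c = c
  isWalk : IsWalk hd.step hd.Ok c y
  exists_final : ∀ s ∈ c.2, ∃ i ≤ y.length, (y.take i).foldl N.slaveNext s ∈ N.final
  exists_acc : ∃ i < y.length, ((y.take i).foldl hd.step c).1 ∈ N.master.acc
  one_le_count : 1 ≤ walkSum hd.step hd.stepCount c y

variable {hd : N.Deterministic}

lemma IsAnchor.ne_nil {c : Q × Multiset (Σ i, S i)} {α y : List A} (h : hd.IsAnchor c α y) :
    y ≠ [] := by
  rintro rfl
  obtain ⟨i, hi, -⟩ := h.exists_acc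
  simp at hi

theorem exists_isAnchor {c : Q × Multiset (Σ i, S i)} (hc : c ∈ hd.recurrent) :
    ∃ α y, hd.IsAnchor c α y := by
  obtain ⟨w, r, hr, hrec⟩ := hc
  have hf := hd.follows r hr
  obtain ⟨b, rfl⟩ := hrec.exists
  obtain ⟨q, hq, hqrec⟩ := hr.1
  obtain ⟨t₁, ht₁, hqt⟩ := frequently_atTop.mp hqrec b
  obtain ⟨t₂, ht₂, hlen⟩ := frequently_atTop.mp hr.2.2 b
  obtain ⟨b', hb', hcb'⟩ := frequently_atTop.mp hrec
    (t₁ + t₂ + 1 + ∑ p ∈ Finset.range b, (p + r.len p))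
  obtain ⟨n, rfl⟩ := Nat.exists_eq_add_of_le (show b ≤ b' by omega)
  refine ⟨factor w 0 b, factor w b n, ⟨?_, ?_, ?_, ?_, ?_, ?_, ?_⟩⟩
  · have := orbit_add (nxt := hd.step) hd.initial w 0 b
    rw [zero_add] at this
    exact this.symm
  · have := isWalk_factor (nxt := hd.step) (P := hd.Ok) (c := hd.initial) (w := w) (s := 0)
      (n := b)
    exact this.mpr fun t _ => hf.ok _
  · exact (orbit_add (nxt := hd.step) hd.initial w b n).symm.trans hcb'
  · exact isWalk_factor.mpr fun t _ => hf.ok _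
  · intro s hs
    rw [path_snd, ← hf.pending_eq] at hs
    obtain ⟨p, hp, rfl⟩ := Multiset.mem_map.mp hs
    have hp' : p < b ∧ b < p + r.len p := by
      simpa only [Run.pending, Finset.mem_val, Finset.mem_filter, Finset.mem_range] using hp
    have hle : p + r.len p ≤ ∑ p ∈ Finset.range b, (p + r.len p) :=
      Finset.single_le_sum (f := fun p => p + r.len p) (fun _ _ => Nat.zero_le _)
        (Finset.mem_range.mpr hp'.1)
    refine ⟨p + r.len p - b, by rw [length_factor]; omega, ?_⟩
    rw [take_factor _ _ (by omega)]
    have h1 := hd.slaveAt_add w p (b - p) (p + r.len p - b)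
    rw [show b - p + (p + r.len p - b) = r.len p by omega,
      show p + (b - p) = b by omega] at h1
    rw [← h1]
    exact hf.mem_final p
  · refine ⟨t₁ - b, by rw [length_factor]; omega, ?_⟩
    rw [take_factor _ _ (by omega)]
    have h1 := orbit_add (nxt := hd.step) hd.initial w b (t₁ - b)
    rw [show b + (t₁ - b) = t₁ by omega] at h1
    have h2 : (hd.path w t₁).1 ∈ N.master.acc := by rw [← hf.state_eq, hqt]; exact hq
    rwa [path, h1] at h2
  · have h1 := walkSum_factor (nxt := hd.step) hd.stepCount hd.initial w b n
    refine le_of_le_of_eq ?_ h1.symm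
    have h2 : hd.stepCount (hd.path w (b + (t₂ - b))) (w (b + (t₂ - b))) = 1 := by
      rw [show b + (t₂ - b) = t₂ by omega, hf.stepCount_eq, if_pos hlen]
    rw [← h2]
    exact Finset.single_le_sum
      (f := fun t => hd.stepCount (hd.path w (b + t)) (w (b + t)))
      (fun _ _ => hd.stepCount_nonneg _ _) (Finset.mem_range.mpr (by omega))

/-- A word of the form `α z^(m 0) y z^(m 1) y …` where `z` is a closed walk at the configuration
`c` and `α`, `y` anchor `c`. -/
structure IsPumped (hd : N.Deterministic) (c : Q × Multiset (Σ i, S i)) (α y z : List A)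
    (m : ℕ → ℕ) (w : ℕ → A) : Prop where
  anchor : hd.IsAnchor c α y
  foldl_eq : z.foldl hd.step c = c
  isWalk : IsWalk hd.step hd.Ok c z
  isBlockWord : IsBlockWord w α fun j => (List.replicate (m j) z).flatten ++ y

/-- The position at which block number `j` of a pumped word starts. -/
def pumpStart (α y z : List A) (m : ℕ → ℕ) (j : ℕ) : ℕ :=
  blockStart α (fun j => (List.replicate (m j) z).flatten ++ y) j

lemma pumpStart_succ (α y z : List A) (m : ℕ → ℕ) (j : ℕ) :
    pumpStart α y z m (j + 1) = pumpStart α y z m j + m j * z.length + y.length := by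
  simp [pumpStart, blockStart_succ, add_assoc]

namespace IsPumped

variable {c : Q × Multiset (Σ i, S i)} {α y z : List A} {m : ℕ → ℕ} {w : ℕ → A}

lemma le_pumpStart (h : hd.IsPumped c α y z m w) (j : ℕ) : j ≤ pumpStart α y z m j :=
  le_blockStart (fun _ => by simp [h.anchor.ne_nil]) j

lemma factor_eq (h : hd.IsPumped c α y z m w) (j : ℕ) :
    factor w (pumpStart α y z m j) (m j * z.length) = (List.replicate (m j) z).flatten ∧
      factor w (pumpStart α y z m j + m j * z.length) y.length = y := by
  have := factor_eq_append (h.isBlockWord.2 j)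
  simpa [pumpStart] using this

lemma path_pumpStart (h : hd.IsPumped c α y z m w) (j : ℕ) :
    hd.path w (pumpStart α y z m j) = c ∧
      hd.path w (pumpStart α y z m j + m j * z.length) = c := by
  have key : ∀ j, hd.path w (pumpStart α y z m j) = c →
      hd.path w (pumpStart α y z m j + m j * z.length) = c := fun j hj => by
    have h1 := orbit_add (nxt := hd.step) hd.initial w (pumpStart α y z m j) (m j * z.length)
    rw [(h.factor_eq j).1] at h1
    refine h1.trans ?_
    change List.foldl hd.step (hd.path w _) _ = c
    rw [hj, foldl_flatten_replicate h.foldl_eq]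
  suffices hs : hd.path w (pumpStart α y z m j) = c from ⟨hs, key j hs⟩
  induction j with
  | zero =>
    have h1 := orbit_add (nxt := hd.step) hd.initial w 0 α.length
    rw [h.isBlockWord.1, zero_add] at h1
    have h2 : pumpStart α y z m 0 = α.length := by simp [pumpStart, blockStart]
    rw [h2]
    exact h1.trans h.anchor.start_foldl
  | succ j ih =>
    have h1 := orbit_add (nxt := hd.step) hd.initial w
      (pumpStart α y z m j + m j * z.length) y.length
    rw [(h.factor_eq j).2] at h1
    rw [pumpStart_succ]
    refine h1.trans ?_
    change List.foldl hd.step (hd.path w _) _ = c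
    rw [key j ih, h.anchor.foldl_eq]

lemma ok (h : hd.IsPumped c α y z m w) (t : ℕ) : hd.Ok (hd.path w t) (w t) := by
  suffices hs : ∀ j, ∀ t < pumpStart α y z m j, hd.Ok (hd.path w t) (w t) from
    hs (t + 1) t (h.le_pumpStart (t + 1))
  intro j
  induction j with
  | zero =>
    intro t ht
    have h1 := (isWalk_factor (nxt := hd.step) (P := hd.Ok) (c := hd.initial) (w := w)
      (s := 0) (n := α.length)).mp
      (by rw [h.isBlockWord.1]; exact h.anchor.start_isWalk) t
      (by simpa [pumpStart, blockStart] using ht)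
    rwa [zero_add] at h1
  | succ j ih =>
    intro t ht
    rw [pumpStart_succ] at ht
    rcases lt_or_ge t (pumpStart α y z m j) with h1 | h1
    · exact ih t h1
    · obtain ⟨d, rfl⟩ := Nat.exists_eq_add_of_le h1
      refine (isWalk_factor (nxt := hd.step) (P := hd.Ok) (c := hd.initial) (w := w)
        (s := pumpStart α y z m j) (n := m j * z.length + y.length)).mp ?_ d (by omega)
      rw [factor_add, (h.factor_eq j).1, (h.factor_eq j).2]
      change IsWalk hd.step hd.Ok (hd.path w _) _
      rw [(h.path_pumpStart j).1, isWalk_append, foldl_flatten_replicate h.foldl_eq]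
      exact ⟨isWalk_flatten_replicate h.foldl_eq h.isWalk _, h.anchor.isWalk⟩

/-- The sum over the part of block `j` that repeats `z`. -/
lemma sum_pump (h : hd.IsPumped c α y z m w) (f : Q × Multiset (Σ i, S i) → A → ℝ) (j : ℕ) :
    ∑ t ∈ Finset.range (m j * z.length), f (hd.path w (pumpStart α y z m j + t))
      (w (pumpStart α y z m j + t)) = m j * walkSum hd.step f c z := by
  have h1 := walkSum_factor (nxt := hd.step) f hd.initial w
    (pumpStart α y z m j) (m j * z.length)
  rw [(h.factor_eq j).1] at h1
  refine h1.symm.trans ?_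
  change walkSum hd.step f (hd.path w _) _ = _
  rw [(h.path_pumpStart j).1, walkSum_flatten_replicate _ h.foldl_eq]

/-- The sum over all positions before block `j`. -/
lemma sum_range (h : hd.IsPumped c α y z m w) (f : Q × Multiset (Σ i, S i) → A → ℝ) (j : ℕ) :
    ∑ t ∈ Finset.range (pumpStart α y z m j), f (hd.path w t) (w t) =
      walkSum hd.step f hd.initial α + (∑ i ∈ Finset.range j, (m i : ℝ)) *
        walkSum hd.step f c z + j * walkSum hd.step f c y := by
  induction j with
  | zero =>
    have h1 := walkSum_factor (nxt := hd.step) f hd.initial w 0 α.length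
    rw [h.isBlockWord.1] at h1
    simpa [pumpStart, blockStart, path, orbit] using h1.symm
  | succ j ih =>
    have h1 := walkSum_factor (nxt := hd.step) f hd.initial w
      (pumpStart α y z m j + m j * z.length) y.length
    rw [(h.factor_eq j).2] at h1
    change walkSum hd.step f (hd.path w _) y =
      ∑ t ∈ Finset.range y.length, f (hd.path w _) _ at h1
    rw [(h.path_pumpStart j).2] at h1
    rw [pumpStart_succ, Finset.sum_range_add, Finset.sum_range_add, ih, h.sum_pump, ← h1,
      Finset.sum_range_succ]
    push_cast
    ring

/-- A slave that is invoked before the copy of `y` in block `j` ends within this block. -/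
lemma exists_final (h : hd.IsPumped c α y z m w) {p j : ℕ}
    (hp : p < pumpStart α y z m j + m j * z.length) :
    ∃ i, p + i ≤ pumpStart α y z m (j + 1) ∧ hd.slaveAt w p i ∈ N.final := by
  set e := pumpStart α y z m j + m j * z.length with he
  by_cases hfin : ∃ i ≤ e - p, hd.slaveAt w p i ∈ N.final
  · obtain ⟨i, hi, hi'⟩ := hfin
    refine ⟨i, ?_, hi'⟩
    rw [pumpStart_succ]
    omega
  · push Not at hfin
    have h1 := hd.mem_path_snd hp hfin
    rw [(h.path_pumpStart j).2] at h1
    obtain ⟨i, hi, hi'⟩ := h.anchor.exists_final _ h1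
    refine ⟨e - p + i, by rw [pumpStart_succ]; omega, ?_⟩
    rw [slaveAt_add, show p + (e - p) = e by omega]
    rwa [← (h.factor_eq j).2, take_factor _ _ hi] at hi'

theorem exists_accepting (h : hd.IsPumped c α y z m w) : ∃ r : N.Run w, r.Accepting := by
  refine hd.exists_accepting h.ok ?_ ?_ ?_
  · obtain ⟨i, hi, hacc⟩ := h.anchor.exists_acc
    refine ⟨_, hacc, frequently_atTop.mpr fun j =>
      ⟨pumpStart α y z m j + m j * z.length + i, ?_, ?_⟩⟩
    · have := h.le_pumpStart j
      omega
    · have h1 := orbit_add (nxt := hd.step) hd.initial w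
        (pumpStart α y z m j + m j * z.length) i
      rw [← take_factor w _ hi.le, (h.factor_eq j).2] at h1
      change hd.path w _ = List.foldl hd.step (hd.path w _) _ at h1
      rw [h1, (h.path_pumpStart j).2]
  · intro p
    have := h.le_pumpStart (p + 1)
    obtain ⟨i, -, hi⟩ := h.exists_final (p := p) (j := p + 1) (by omega)
    exact ⟨i, hi⟩
  · rw [frequently_atTop]
    intro j
    by_contra! hcon
    have h1 := walkSum_factor (nxt := hd.step) hd.stepCount hd.initial w
      (pumpStart α y z m j + m j * z.length) y.length
    rw [(h.factor_eq j).2] at h1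
    change walkSum hd.step hd.stepCount (hd.path w _) y =
      ∑ t ∈ Finset.range y.length, hd.stepCount (hd.path w _) _ at h1
    rw [(h.path_pumpStart j).2, Finset.sum_eq_zero] at h1
    · have := h.anchor.one_le_count
      linarith
    · intro t _
      have := h.le_pumpStart j
      exact if_pos (hcon _ (by omega))

lemma add_len_le (h : hd.IsPumped c α y z m w) {r : N.Run w} (hr : r.Accepting) {p j : ℕ}
    (hp : p < pumpStart α y z m j + m j * z.length) :
    p + r.len p ≤ pumpStart α y z m (j + 1) := by
  obtain ⟨i, hi, hfin⟩ := h.exists_final hp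
  have h1 : ¬ i < r.len p := fun hlt => (hd.follows r hr).notMem_final p i hlt hfin
  omega

end IsPumped

lemma exists_isPumped {c : Q × Multiset (Σ i, S i)} {α y z : List A} (ha : hd.IsAnchor c α y)
    (hz : z.foldl hd.step c = c) (hz' : IsWalk hd.step hd.Ok c z) (m : ℕ → ℕ) :
    ∃ w, hd.IsPumped c α y z m w := by
  obtain ⟨w, hw⟩ := exists_isBlockWord α (fun j => (List.replicate (m j) z).flatten ++ y)
    fun _ => by simp [ha.ne_nil]
  exact ⟨w, ha, hz, hz', hw⟩

end Deterministic

end NWA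

namespace NWA

variable {A Q ι : Type*} {S : ι → Type*} {N : NWA A Q ι S}

namespace Deterministic

variable {hd : N.Deterministic} {k : ℕ} {B K : ℝ}

/-! ### Closed walks and lower bounds on the values of runs -/

/-- The slaves pending at position `b` of an accepting run still collect at most `k * (n * B)` if
they all end within `n` letters. -/
lemma pendingSum_le_of_width (hd : N.Deterministic) (hwidth : N.HasWidth k) (hB0 : 0 ≤ B)
    (hB : ∀ s a, |(N.slaveWeight s a : ℝ)| ≤ B) {w : ℕ → A} {r : N.Run w} (hr : r.Accepting)
    {b n : ℕ} (hn : ∀ p < b, p + r.len p ≤ b + n) : (r.pendingSum b : ℝ) ≤ k * (n * B) := by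
  have hf := hd.follows r hr
  refine (r.pendingSum_le (n := n) hB0 (fun p hp => hn p ?_) fun p j hj => ?_).trans ?_
  · exact Finset.mem_range.mp (Finset.mem_filter.mp hp).1
  · rw [hf.weight_eq p j hj]
    exact (le_abs_self _).trans (hB _ _)
  · refine mul_le_mul_of_nonneg_right ?_ (by positivity)
    exact_mod_cast hwidth w r hr b

/-- A closed walk at a recurrent configuration that invokes no non-silent slave has no negative
sum of weights. Otherwise, the active slaves accumulate arbitrarily small sums on a word on which
the walk is repeated often. -/
lemma walkSum_stepWeight_nonneg (hwidth : N.HasWidth k) (hB0 : 0 ≤ B)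
    (hB : ∀ s a, |(N.slaveWeight s a : ℝ)| ≤ B)
    (hK : ∀ (w : ℕ → A) (r : N.Run w), r.Accepting → ∀ᶠ b in atTop, K ≤ r.tailSum b)
    {c : Q × Multiset (Σ i, S i)} (hc : c ∈ hd.recurrent) {z : List A}
    (hz : z.foldl hd.step c = c) (hz' : IsWalk hd.step hd.Ok c z)
    (hcount : walkSum hd.step hd.stepCount c z = 0) : 0 ≤ walkSum hd.step hd.stepWeight c z := by
  by_contra! hneg
  have hne : z ≠ [] := by
    rintro rfl
    simp [walkSum] at hneg
  have hzpos := List.length_pos_iff.mpr hne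
  obtain ⟨α, y, ha⟩ := exists_isAnchor hc
  obtain ⟨n, hn⟩ := exists_nat_gt
    ((k * (y.length * B) - K) / -walkSum hd.step hd.stepWeight c z)
  rw [div_lt_iff₀ (by linarith)] at hn
  obtain ⟨w, hw⟩ := exists_isPumped ha hz hz' fun _ => n + 1
  obtain ⟨r, hr⟩ := hw.exists_accepting
  have hf := hd.follows r hr
  obtain ⟨b₀, hb₀⟩ := eventually_atTop.mp (hK w r hr)
  have htail := hb₀ _ (hw.le_pumpStart b₀)
  set s := pumpStart α y z (fun _ => n + 1) b₀ with hs
  have hsilent : ∀ t < (n + 1) * z.length, r.slaveSum (s + t) = 0 := by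
    intro t ht
    have h1 := hw.sum_pump hd.stepCount b₀
    rw [hcount, mul_zero, Finset.sum_eq_zero_iff_of_nonneg
      (fun _ _ => hd.stepCount_nonneg _ _)] at h1
    have h2 := h1 t (Finset.mem_range.mpr ht)
    rw [hf.stepCount_eq] at h2
    have h3 : r.len (s + t) = 0 := by
      by_contra hlen
      rw [if_pos (Nat.pos_of_ne_zero hlen)] at h2
      exact one_ne_zero h2
    simp [Run.slaveSum, h3]
  have h1 := hf.sum_slaveSum_eq s
  have h2 := hf.sum_slaveSum_eq (s + (n + 1) * z.length)
  rw [Finset.sum_range_add, Finset.sum_range_add, hw.sum_pump] at h2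
  have h3 : ∑ x ∈ Finset.range ((n + 1) * z.length), (r.slaveSum (s + x) : ℝ) = 0 :=
    Finset.sum_eq_zero fun t ht => by rw [hsilent t (Finset.mem_range.mp ht)]; simp
  have h4 : (r.pendingSum (s + (n + 1) * z.length) : ℝ) ≤ k * (y.length * B) := by
    refine pendingSum_le_of_width hd hwidth hB0 hB hr fun p hp => ?_
    have := hw.add_len_le hr hp
    rwa [pumpStart_succ] at this
  have h5 : r.slaveSum s = 0 := hsilent 0 (by positivity)
  rw [r.tailSum_eq_slaveSum_add, h5, zero_add] at htail
  push_cast at h2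
  linarith

/-- The steps that stay among the recurrent configurations. -/
def RecurrentOk (hd : N.Deterministic) (c : Q × Multiset (Σ i, S i)) (a : A) : Prop :=
  c ∈ hd.recurrent ∧ hd.Ok c a

lemma isWalk_ok_of_recurrentOk {c : Q × Multiset (Σ i, S i)} {u : List A}
    (h : IsWalk hd.step hd.RecurrentOk c u) : IsWalk hd.step hd.Ok c u :=
  h.mono fun _ _ h => h.2

section Finite

variable [Finite Q] [Finite ι] [∀ i, Finite (S i)]

/-- The sums along an accepting run are bounded below if the short closed walks among the
recurrent configurations have no negative sums. -/
lemma exists_sum_path_ge (hwidth : N.HasWidth k) {f : Q × Multiset (Σ i, S i) → A → ℝ} {C : ℝ}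
    (hC : 0 ≤ C) (hf : ∀ c a, c ∈ hd.recurrent → -C ≤ f c a)
    (hcyc : ∀ c u, IsWalk hd.step hd.RecurrentOk c u → u.foldl hd.step c = c →
      u.length ≤ (finite_recurrent (hd := hd) hwidth).toFinset.card →
      0 ≤ walkSum hd.step f c u) {w : ℕ → A} {r : N.Run w} (hr : r.Accepting) :
    ∃ C' : ℝ, ∀ᶠ b in atTop, -C' ≤ ∑ t ∈ Finset.range b, f (hd.path w t) (w t) := by
  obtain ⟨b₀, hb₀⟩ := eventually_atTop.mp (eventually_mem_recurrent (hd := hd) hwidth hr)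
  refine ⟨C * (finite_recurrent (hd := hd) hwidth).toFinset.card -
    ∑ t ∈ Finset.range b₀, f (hd.path w t) (w t), ?_⟩
  filter_upwards [eventually_ge_atTop b₀] with b hb
  obtain ⟨n, rfl⟩ := Nat.exists_eq_add_of_le hb
  have h1 := walkSum_ge (nxt := hd.step) (P := hd.RecurrentOk) hC
    (finite_recurrent (hd := hd) hwidth).toFinset (fun c a h => by simpa using h.1)
    (fun c a h => hf c a h.1) hcyc (orbit hd.step hd.initial w b₀) (factor w b₀ n)
    (isWalk_factor.mpr fun t _ => ⟨hb₀ _ (by omega), (hd.follows r hr).ok _⟩)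
  rw [walkSum_factor] at h1
  rw [Finset.sum_range_add]
  change _ ≤ ∑ t ∈ Finset.range n, f (hd.path w _) _ at h1
  linarith

lemma exists_closed_walk_count_pos (hwidth : N.HasWidth k) {w : ℕ → A} {r : N.Run w}
    (hr : r.Accepting) : ∃ c u, IsWalk hd.step hd.RecurrentOk c u ∧ u.foldl hd.step c = c ∧
      u.length ≤ (finite_recurrent (hd := hd) hwidth).toFinset.card ∧
      0 < walkSum hd.step hd.stepCount c u := by
  by_contra! hcon
  -- Otherwise the negated count is bounded below along the run.
  obtain ⟨C, hC⟩ := exists_sum_path_ge (hd := hd) hwidth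
    (f := fun c a => hd.stepCount c a - 2 * hd.stepCount c a) zero_le_one
    (fun c a _ => by have := hd.stepCount_le_one c a; linarith)
    (fun c u h1 h2 h3 => by
      rw [walkSum_sub_mul]
      linarith [hcon c u h1 h2 h3]) hr
  have hf := hd.follows r hr
  obtain ⟨b₀, hb₀⟩ := eventually_atTop.mp hC
  obtain ⟨n, hn⟩ := exists_nat_gt C
  have hinf : {p | 0 < r.len p}.Infinite := Nat.frequently_atTop_iff_infinite.mp hr.2.2
  have h1 := hb₀ (max b₀ (Nat.nth (fun p => 0 < r.len p) n)) (le_max_left _ _)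
  rw [Finset.sum_sub_distrib, ← Finset.mul_sum, ← hf.count_eq] at h1
  have h2 : n ≤ Nat.count (fun p => 0 < r.len p)
      (max b₀ (Nat.nth (fun p => 0 < r.len p) n)) := by
    refine le_trans ?_ (Nat.count_monotone _ (le_max_right _ _))
    rw [Nat.count_nth_of_infinite hinf]
  have h3 : (n : ℝ) ≤ Nat.count (fun p => 0 < r.len p)
      (max b₀ (Nat.nth (fun p => 0 < r.len p) n)) := by exact_mod_cast h2
  linarith

/-- If `μ` is a lower bound on the ratios of weight and count of the short closed walks, then it
is a lower bound on the values of the accepting runs. -/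
lemma le_run_value (hwidth : N.HasWidth k) (hB0 : 0 ≤ B)
    (hB : ∀ s a, |(N.slaveWeight s a : ℝ)| ≤ B)
    (hK : ∀ (w : ℕ → A) (r : N.Run w), r.Accepting → ∀ᶠ b in atTop, K ≤ r.tailSum b) {μ : ℝ}
    (hμ : ∀ c u, IsWalk hd.step hd.RecurrentOk c u → u.foldl hd.step c = c →
      u.length ≤ (finite_recurrent (hd := hd) hwidth).toFinset.card →
      0 < walkSum hd.step hd.stepCount c u →
      μ * walkSum hd.step hd.stepCount c u ≤ walkSum hd.step hd.stepWeight c u)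
    {w : ℕ → A} {r : N.Run w} (hr : r.Accepting) : (μ : EReal) ≤ r.value := by
  have hf := hd.follows r hr
  obtain ⟨C, hC⟩ := exists_sum_path_ge (hd := hd) hwidth
    (f := fun c a => hd.stepWeight c a - μ * hd.stepCount c a) (C := (k + 1) * B + |μ|)
    (by positivity)
    (fun c a hc => by
      have h1 := abs_le.mp (abs_stepWeight_le (hd := hd) hB hB0
        (card_snd_le_of_mem_recurrent hwidth hc) a)
      have h2 : μ * hd.stepCount c a ≤ |μ| := by
        refine (le_abs_self _).trans ?_
        rw [abs_mul, abs_of_nonneg (hd.stepCount_nonneg c a)]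
        exact mul_le_of_le_one_right (abs_nonneg μ) (hd.stepCount_le_one c a)
      linarith [h1.1])
    (fun c u h1 h2 h3 => by
      rw [walkSum_sub_mul]
      rcases (walkSum_nonneg (nxt := hd.step) hd.stepCount_nonneg c u).eq_or_lt with h4 | h4
      · rw [← h4, mul_zero, sub_zero]
        cases u with
        | nil => simp [walkSum]
        | cons a u =>
          exact walkSum_stepWeight_nonneg hwidth hB0 hB hK h1.1.1 h2
            (isWalk_ok_of_recurrentOk h1) h4.symm
      · linarith [hμ c u h1 h2 h3 h4]) hr
  have hinf : {p | 0 < r.len p}.Infinite := Nat.frequently_atTop_iff_infinite.mp hr.2.2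
  refine le_limAvg (C := C - K + μ) ?_
  obtain ⟨b₀, hb₀⟩ := eventually_atTop.mp (hC.and (hK w r hr))
  filter_upwards [eventually_ge_atTop (b₀ + 1)] with n hn
  obtain ⟨n, rfl⟩ := Nat.exists_eq_add_of_le' (show 1 ≤ n by omega)
  have hcount : Nat.count (fun p => 0 < r.len p) (r.invocation n) = n :=
    Nat.count_nth_of_infinite hinf n
  have hcount' : Nat.count (fun p => 0 < r.len p) (r.invocation n + 1) = n + 1 := by
    have hlen : 0 < r.len (r.invocation n) := Nat.nth_mem_of_infinite hinf n
    rw [Nat.count_succ, hcount, if_pos hlen]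
  obtain ⟨h1, h2⟩ := hb₀ (r.invocation n) (by
    have : n ≤ r.invocation n := (Nat.nth_strictMono hinf).le_apply
    omega)
  have h3 := r.sum_invocation (r.invocation n + 1)
  rw [hcount', Finset.sum_range_succ _ (r.invocation n), hf.sum_slaveSum_eq] at h3
  rw [h3]
  rw [Finset.sum_sub_distrib, ← Finset.mul_sum, ← hf.count_eq, hcount] at h1
  rw [r.tailSum_eq_slaveSum_add] at h2
  push_cast at h2 ⊢
  linarith

/-- Among the closed walks at recurrent configurations there is one whose ratio of weight and count
is a lower bound on the values of all accepting runs. -/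
theorem exists_optimal_closed_walk [Finite A] (hwidth : N.HasWidth k)
    (hstar : ¬ N.ConditionStar k) (hacc : ∃ u : ℕ → A, N.Accepts u) :
    ∃ c ∈ hd.recurrent, ∃ z : List A, z.foldl hd.step c = c ∧ IsWalk hd.step hd.Ok c z ∧
      0 < walkSum hd.step hd.stepCount c z ∧ ∀ (w : ℕ → A) (r : N.Run w), r.Accepting →
        ((walkSum hd.step hd.stepWeight c z / walkSum hd.step hd.stepCount c z : ℝ) : EReal) ≤
          r.value := by
  obtain ⟨B, hB0, hB⟩ := exists_slaveWeight_bound N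
  obtain ⟨K, hK⟩ := exists_tailSum_bound hd hstar
  obtain ⟨w, r, hr⟩ := hacc
  let E : Set ((Q × Multiset (Σ i, S i)) × List A) := {x |
    IsWalk hd.step hd.RecurrentOk x.1 x.2 ∧ x.2.foldl hd.step x.1 = x.1 ∧
      x.2.length ≤ (finite_recurrent (hd := hd) hwidth).toFinset.card ∧
      0 < walkSum hd.step hd.stepCount x.1 x.2}
  have hmem : ∀ x ∈ E, x.1 ∈ hd.recurrent := by
    rintro ⟨c, u⟩ ⟨h1, -, -, h4⟩
    cases u with
    | nil => simp [walkSum] at h4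
    | cons a u => exact h1.1.1
  have hfin : E.Finite := by
    refine ((finite_recurrent (hd := hd) hwidth).prod (List.finite_length_le A
      (finite_recurrent (hd := hd) hwidth).toFinset.card)).subset ?_
    exact fun x hx => ⟨hmem x hx, hx.2.2.1⟩
  obtain ⟨c, u, h⟩ := exists_closed_walk_count_pos (hd := hd) hwidth hr
  obtain ⟨⟨c, z⟩, hz, hmin⟩ := Set.exists_min_image E
    (fun x => walkSum hd.step hd.stepWeight x.1 x.2 / walkSum hd.step hd.stepCount x.1 x.2)
    hfin ⟨(c, u), h⟩
  refine ⟨c, hmem _ hz, z, hz.2.1, isWalk_ok_of_recurrentOk hz.1, hz.2.2.2, fun w r hr => ?_⟩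
  refine le_run_value (hd := hd) hwidth hB0 hB hK (fun c u h1 h2 h3 h4 => ?_) hr
  rw [← le_div_iff₀ h4]
  exact hmin (c, u) ⟨h1, h2, h3, h4⟩

end Finite

/-! ### The values of pumped words -/

/-- Before block `j` of a pumped word at least `j` non-silent slaves are invoked, and the count grows
at least as fast as the number of the copies of `z`. -/
lemma IsPumped.count_ge {c : Q × Multiset (Σ i, S i)} {α y z : List A} {m : ℕ → ℕ} {w : ℕ → A}
    (h : hd.IsPumped c α y z m w) {r : N.Run w} (hr : r.Accepting) (j : ℕ) :
    j + (∑ i ∈ Finset.range j, (m i : ℝ)) * walkSum hd.step hd.stepCount c z ≤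
      Nat.count (fun p => 0 < r.len p) (pumpStart α y z m j) := by
  rw [(hd.follows r hr).count_eq, h.sum_range]
  have h1 := walkSum_nonneg (nxt := hd.step) hd.stepCount_nonneg hd.initial α
  have h2 := mul_le_mul_of_nonneg_left h.anchor.one_le_count (Nat.cast_nonneg (α := ℝ) j)
  linarith

/-- The contribution of the copies of `z` to the sum of the slave values of a pumped word is exactly
proportional to the number of slaves that they invoke. The rest is negligible if `z` is repeated
often. -/
lemma exists_pumped_value_bound [Finite A] [Finite ι] [∀ i, Finite (S i)] (hwidth : N.HasWidth k)
    {c : Q × Multiset (Σ i, S i)} {α y z : List A}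
    (hpos : 0 < walkSum hd.step hd.stepCount c z) :
    ∃ C : ℝ, 0 ≤ C ∧ ∀ (m : ℕ → ℕ) (w : ℕ → A) (r : N.Run w), hd.IsPumped c α y z m w →
      r.Accepting → ∀ ε : ℝ, 0 < ε →
      (∃ᶠ j : ℕ in atTop, C * (1 + j + m j) ≤ ε * ∑ i ∈ Finset.range j, (m i : ℝ)) →
      r.value ≤ ((walkSum hd.step hd.stepWeight c z / walkSum hd.step hd.stepCount c z + ε : ℝ) :
        EReal) := by
  obtain ⟨B, hB0, hB⟩ := exists_slaveWeight_bound N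
  set μ := walkSum hd.step hd.stepWeight c z / walkSum hd.step hd.stepCount c z with hμ
  have hμz : μ * walkSum hd.step hd.stepCount c z = walkSum hd.step hd.stepWeight c z :=
    div_mul_cancel₀ _ hpos.ne'
  set Cα := walkSum hd.step hd.stepWeight hd.initial α -
    μ * walkSum hd.step hd.stepCount hd.initial α with hCα
  set Cy := walkSum hd.step hd.stepWeight c y - μ * walkSum hd.step hd.stepCount c y with hCy
  set Ck := k * B * (z.length + y.length) with hCk
  have hCk0 : 0 ≤ Ck := by positivity
  refine ⟨(|Cα| + |Cy| + Ck) / walkSum hd.step hd.stepCount c z, by positivity,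
    fun m w r h hr ε hε hfreq => ?_⟩
  have hf := hd.follows r hr
  refine limAvg_le (frequently_atTop.mpr fun n₀ => ?_)
  obtain ⟨j, hj, hle⟩ := frequently_atTop.mp hfreq n₀
  have hcount := h.count_ge hr j
  set M := ∑ i ∈ Finset.range j, (m i : ℝ) with hM
  have hM0 : 0 ≤ M := Finset.sum_nonneg fun _ _ => Nat.cast_nonneg _
  set n := Nat.count (fun p => 0 < r.len p) (pumpStart α y z m j) with hn
  refine ⟨n, ?_, ?_⟩
  · have : (j : ℝ) ≤ n := by
      have := mul_nonneg hM0 hpos.le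
      linarith
    have : j ≤ n := by exact_mod_cast this
    omega
  · rw [r.sum_invocation, hf.sum_slaveSum_eq, h.sum_range]
    have h1 : (n : ℝ) = _ := (hf.count_eq _).trans (h.sum_range hd.stepCount j)
    have h2 : (r.pendingSum (pumpStart α y z m j) : ℝ) ≤
        k * (((m j * z.length + y.length : ℕ) : ℝ) * B) := by
      refine pendingSum_le_of_width hd hwidth hB0 hB hr fun p hp => ?_
      have := h.add_len_le hr (p := p) (j := j) (by omega)
      rw [pumpStart_succ] at this
      omega
    have h3 : k * (((m j * z.length + y.length : ℕ) : ℝ) * B) ≤ Ck * (1 + m j) := by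
      push_cast
      rw [hCk]
      have hkB : 0 ≤ k * B := by positivity
      have : (m j * z.length + y.length : ℝ) ≤ (z.length + y.length) * (1 + m j) := by
        nlinarith [Nat.cast_nonneg (α := ℝ) z.length, Nat.cast_nonneg (α := ℝ) y.length,
          Nat.cast_nonneg (α := ℝ) (m j),
          mul_nonneg (Nat.cast_nonneg (α := ℝ) y.length) (Nat.cast_nonneg (α := ℝ) (m j))]
      have := mul_le_mul_of_nonneg_left this hkB
      linarith
    have h4 : (|Cα| + |Cy| + Ck) * (1 + j + m j) ≤ ε * n := by
      rw [div_mul_eq_mul_div, div_le_iff₀ hpos] at hle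
      refine hle.trans ?_
      rw [mul_assoc]
      refine mul_le_mul_of_nonneg_left ?_ hε.le
      linarith [Nat.cast_nonneg (α := ℝ) j]
    have h5 : Cα + j * Cy + Ck * (1 + m j) ≤ (|Cα| + |Cy| + Ck) * (1 + j + m j) := by
      have hj0 := Nat.cast_nonneg (α := ℝ) j
      have hm0 := Nat.cast_nonneg (α := ℝ) (m j)
      have e1 := le_abs_self Cα
      have e2 := mul_le_mul_of_nonneg_left (le_abs_self Cy) hj0
      nlinarith [mul_nonneg (abs_nonneg Cα) hj0, mul_nonneg (abs_nonneg Cα) hm0,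
        mul_nonneg (abs_nonneg Cy) hm0, abs_nonneg Cy, mul_nonneg hCk0 hj0]
    rw [add_mul, h1, ← hμz]
    rw [h1] at h4
    linarith

/-- On a word on which the walk `z` is repeated `Nat.log 2 (j + 1)` times in block `j`, the `i`-th
invoked slave takes `O(log i)` steps. -/
lemma IsPumped.dense {c : Q × Multiset (Σ i, S i)} {α y z : List A} {w : ℕ → A}
    (h : hd.IsPumped c α y z (fun j => Nat.log 2 (j + 1)) w)
    {r : N.Run w} (hr : r.Accepting) : N.Dense w := by
  refine ⟨r, hr, IsBigO.of_bound ((4 * z.length + 2 * y.length) / Real.log 2) ?_⟩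
  have hinf : {p | 0 < r.len p}.Infinite := Nat.frequently_atTop_iff_infinite.mp hr.2.2
  set s := pumpStart α y z (fun j => Nat.log 2 (j + 1)) with hs
  filter_upwards [eventually_ge_atTop (s 0 + 1)] with i hi
  set p := r.invocation i with hp
  have hip : i ≤ p := (Nat.nth_strictMono hinf).le_apply
  have hex : ∃ j, p < s (j + 1) := ⟨p, h.le_pumpStart (p + 1)⟩
  obtain ⟨j, hjle, hjlt⟩ : ∃ j, s j ≤ p ∧ p < s (j + 1) := by
    classical
    refine ⟨Nat.find hex, ?_, Nat.find_spec hex⟩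
    by_contra! hlt
    rcases Nat.eq_zero_or_pos (Nat.find hex) with h0 | h0
    · rw [h0] at hlt
      omega
    · obtain ⟨l, hl⟩ := Nat.exists_eq_add_of_le' h0
      exact Nat.find_min hex (m := l) (by omega) (by rwa [hl] at hlt)
  have hji : j ≤ i := by
    have h1 := h.count_ge hr j
    have h2 : (0 : ℝ) ≤ (∑ i ∈ Finset.range j, ((Nat.log 2 (i + 1) : ℕ) : ℝ)) *
        walkSum hd.step hd.stepCount c z :=
      mul_nonneg (Finset.sum_nonneg fun _ _ => Nat.cast_nonneg _)
        (walkSum_nonneg hd.stepCount_nonneg c z)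
    have h3 : (j : ℝ) ≤ Nat.count (fun p => 0 < r.len p) (s j) := by linarith
    have h4 : j ≤ Nat.count (fun p => 0 < r.len p) (s j) := by exact_mod_cast h3
    refine h4.trans ((Nat.count_monotone _ hjle).trans ?_)
    exact (Nat.count_nth_of_infinite hinf i).le
  have hlen : p + r.len p ≤ s (j + 1 + 1) := 
    h.add_len_le hr (hjlt.trans_le (Nat.le_add_right _ _))
  have hs1 : s (j + 1) = s j + Nat.log 2 (j + 1) * z.length + y.length := pumpStart_succ _ _ _ _ _
  have hs2 : s (j + 1 + 1) = s (j + 1) + Nat.log 2 (j + 1 + 1) * z.length + y.length :=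
    pumpStart_succ _ _ _ _ _
  have hmono : ∀ l, l ≤ i + 2 → Nat.log 2 l * z.length ≤ Nat.log 2 (i + 2) * z.length :=
    fun l hl => Nat.mul_le_mul_right _ (Nat.log_mono_right hl)
  have hlen' : r.len p ≤ 2 * (Nat.log 2 (i + 2) * z.length) + 2 * y.length := by
    have h1 := hmono (j + 1) (by omega)
    have h2 := hmono (j + 1 + 1) (by omega)
    omega
  have hlog2 : 0 < Real.log 2 := Real.log_pos one_lt_two
  have hi1 : (1 : ℝ) ≤ i := by exact_mod_cast (by omega : 1 ≤ i)
  have hlogi : Real.log 2 ≤ Real.log ((i : ℝ) + 1) :=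
    Real.log_le_log two_pos (by linarith)
  have hnat : (Nat.log 2 (i + 2) : ℝ) * Real.log 2 ≤ 2 * Real.log ((i : ℝ) + 1) := by
    have h1 : ((2 : ℝ) ^ Nat.log 2 (i + 2)) ≤ ((i : ℝ) + 1) ^ 2 := by
      have h2 : ((2 ^ Nat.log 2 (i + 2) : ℕ) : ℝ) ≤ ((i + 2 : ℕ) : ℝ) :=
        Nat.cast_le.mpr (Nat.pow_log_le_self 2 (by omega))
      push_cast at h2
      nlinarith
    have h2 := Real.log_le_log (by positivity) h1
    rw [Real.log_pow, Real.log_pow] at h2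
    exact_mod_cast h2
  rw [Real.norm_of_nonneg (Nat.cast_nonneg _), Real.norm_of_nonneg (hlog2.le.trans hlogi),
    div_mul_eq_mul_div, le_div_iff₀ hlog2]
  have hlen'' : (r.len p : ℝ) ≤ 2 * ((Nat.log 2 (i + 2) : ℝ) * z.length) + 2 * y.length := by
    exact_mod_cast hlen'
  calc (r.len p : ℝ) * Real.log 2
      ≤ (2 * ((Nat.log 2 (i + 2) : ℝ) * z.length) + 2 * y.length) * Real.log 2 :=
        mul_le_mul_of_nonneg_right hlen'' hlog2.le
    _ = 2 * z.length * ((Nat.log 2 (i + 2) : ℝ) * Real.log 2) + 2 * y.length * Real.log 2 := by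
        ring
    _ ≤ 2 * z.length * (2 * Real.log ((i : ℝ) + 1)) +
          2 * y.length * Real.log ((i : ℝ) + 1) := by gcongr
    _ = (4 * z.length + 2 * y.length) * Real.log ((i : ℝ) + 1) := by ring

/-- If `m` tends to infinity and grows at most linearly, then its sums dominate `j + m j`. -/
lemma frequently_le_sum {m : ℕ → ℕ} (hm : Tendsto m atTop atTop) (hle : ∀ j, m j ≤ j) {C ε : ℝ}
    (hC : 0 ≤ C) (hε : 0 < ε) :
    ∃ᶠ j : ℕ in atTop, C * (1 + j + m j) ≤ ε * ∑ i ∈ Finset.range j, (m i : ℝ) := by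
  obtain ⟨n, hn⟩ := exists_nat_ge (4 * C / ε)
  rw [div_le_iff₀ hε] at hn
  obtain ⟨j₀, hj₀⟩ := eventually_atTop.mp (tendsto_atTop.mp hm n)
  refine Eventually.frequently ?_
  filter_upwards [eventually_ge_atTop (2 * j₀ + 1)] with j hj
  obtain ⟨d, rfl⟩ := Nat.exists_eq_add_of_le (show j₀ ≤ j by omega)
  have h1 : (d : ℝ) * n ≤ ∑ i ∈ Finset.range (j₀ + d), (m i : ℝ) := by
    rw [Finset.sum_range_add, ← nsmul_eq_mul]
    have h2 : d • (n : ℝ) ≤ ∑ i ∈ Finset.range d, (m (j₀ + i) : ℝ) := by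
      have := Finset.card_nsmul_le_sum (Finset.range d) (fun i => (m (j₀ + i) : ℝ)) n
        fun i _ => by exact_mod_cast hj₀ _ (by omega)
      simpa using this
    have h3 : 0 ≤ ∑ i ∈ Finset.range j₀, (m i : ℝ) :=
      Finset.sum_nonneg fun _ _ => Nat.cast_nonneg _
    linarith
  have h2 : (m (j₀ + d) : ℝ) ≤ ((j₀ + d : ℕ) : ℝ) := by exact_mod_cast hle _
  have h3 : (j₀ : ℝ) + 1 ≤ d := by exact_mod_cast (by omega : j₀ + 1 ≤ d)
  have h4 := mul_le_mul_of_nonneg_left h1 hε.le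
  push_cast at h2 ⊢
  calc C * (1 + (j₀ + d) + m (j₀ + d)) ≤ C * (4 * d) := by
        refine mul_le_mul_of_nonneg_left ?_ hC
        linarith
    _ = 4 * C * d := by ring
    _ ≤ n * ε * d := by gcongr
    _ = ε * (d * n) := by ring
    _ ≤ _ := h4

end Deterministic

end NWA

theorem lemmal {A Q ι : Type*} {S : ι → Type*}
    [Finite A] [Finite Q] [Finite ι] [∀ i, Finite (S i)]
    (N : NWA A Q ι S) (k : ℕ) (hk : 0 < k)
    (hdet : N.Deterministic) (hwidth : N.HasWidth k) (hstar : ¬ N.ConditionStar k) :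
    ((∃ u : ℕ → A, N.Accepts u) →
      ∀ ε : ℝ, 0 < ε → ∃ (α β : List A) (hβ : β ≠ []) (x y : ℝ),
        (⨅ u : ℕ → A, N.value u) = (x : EReal) ∧
        N.value (lasso α β hβ) = (y : EReal) ∧ |x - y| < ε) ∧
    (⊥ : EReal) < (⨅ u : ℕ → A, N.value u) ∧
    ((∃ u : ℕ → A, N.Accepts u) →
      ∃ w : ℕ → A, N.Dense w ∧ (⨅ u : ℕ → A, N.value u) = N.value w) := by
  by_cases hacc : ∃ u : ℕ → A, N.Accepts u
  swap
  · have htop : (⨅ u : ℕ → A, N.value u) = ⊤ := by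
      refine iInf_eq_top.mpr fun u => iInf_eq_top.mpr fun r => iInf_eq_top.mpr fun hr => ?_
      exact absurd ⟨u, r, hr⟩ hacc
    exact ⟨fun h => absurd h hacc, by rw [htop]; exact bot_lt_top, fun h => absurd h hacc⟩
  obtain ⟨c, hc, z, hz, hz', hpos, hmin⟩ :=
    NWA.Deterministic.exists_optimal_closed_walk (hd := hdet) hwidth hstar hacc
  obtain ⟨α, y, ha⟩ := NWA.Deterministic.exists_isAnchor hc
  obtain ⟨C, hC, hbound⟩ := NWA.Deterministic.exists_pumped_value_bound (α := α) (y := y) hwidth hpos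
  set μ := walkSum hdet.step hdet.stepWeight c z / walkSum hdet.step hdet.stepCount c z
  have hlow : ∀ u, (μ : EReal) ≤ N.value u := fun u =>
    le_iInf fun r => le_iInf fun hr => hmin u r hr
  obtain ⟨w, hw⟩ := NWA.Deterministic.exists_isPumped ha hz hz' fun j => Nat.log 2 (j + 1)
  obtain ⟨r, hr⟩ := hw.exists_accepting
  have hval : N.value w = μ := by
    refine le_antisymm ?_ (hlow w)
    refine (iInf₂_le r hr).trans ?_
    have hε : ∀ ε : ℝ, 0 < ε → r.value ≤ ((μ + ε : ℝ) : EReal) := fun ε hε =>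
      hbound _ w r hw hr ε hε (NWA.Deterministic.frequently_le_sum
        ((tendsto_atTop_atTop_of_monotone Nat.log_monotone fun n =>
          ⟨2 ^ n, (Nat.log_pow one_lt_two n).ge⟩).comp (tendsto_add_atTop_nat 1))
        (fun j => Nat.lt_succ_iff.mp (Nat.log_lt_self 2 j.succ_ne_zero)) hC hε)
    have hne_top : r.value ≠ ⊤ := ne_top_of_le_ne_top (EReal.coe_ne_top _) (hε 1 one_pos)
    have hne_bot : r.value ≠ ⊥ := ne_bot_of_le_ne_bot (EReal.coe_ne_bot _) (hmin w r hr)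
    rw [← EReal.coe_toReal hne_top hne_bot] at hε ⊢
    rw [EReal.coe_le_coe_iff]
    exact le_of_forall_pos_le_add fun ε h => EReal.coe_le_coe_iff.mp (hε ε h)
  have hinf : (⨅ u : ℕ → A, N.value u) = μ :=
    le_antisymm (hval ▸ iInf_le _ w) (le_iInf hlow)
  refine ⟨fun _ ε hε => ?_, by rw [hinf]; exact EReal.bot_lt_coe μ,
    fun _ => ⟨w, hw.dense hr, hinf.trans hval.symm⟩⟩
  -- A constant number `n` of repetitions gives a lasso word, with an error of order `1 / n`.
  obtain ⟨n, hn⟩ := exists_nat_ge (2 * C / (ε / 2))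
  rw [div_le_iff₀ (by linarith)] at hn
  have hβ : (List.replicate n z).flatten ++ y ≠ [] := by simp [ha.ne_nil]
  have hw' : hdet.IsPumped c α y z (fun _ => n) (lasso α _ hβ) :=
    ⟨ha, hz, hz', isBlockWord_lasso α _ hβ⟩
  obtain ⟨r', hr'⟩ := hw'.exists_accepting
  have hup : N.value (lasso α _ hβ) ≤ ((μ + ε / 2 : ℝ) : EReal) := by
    refine (iInf₂_le r' hr').trans (hbound _ _ r' hw' hr' (ε / 2) (by linarith) ?_)
    refine Eventually.frequently ?_
    filter_upwards [eventually_ge_atTop (n + 1)] with j hj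
    have h1 : (n : ℝ) + 1 ≤ j := by exact_mod_cast hj
    have h2 := mul_le_mul_of_nonneg_right hn (Nat.cast_nonneg (α := ℝ) j)
    have h3 := mul_le_mul_of_nonneg_left h1 hC
    rw [Finset.sum_const, Finset.card_range, nsmul_eq_mul]
    linarith
  have hne_top := ne_top_of_le_ne_top (EReal.coe_ne_top _) hup
  have hne_bot := ne_bot_of_le_ne_bot (EReal.coe_ne_bot _) (hlow (lasso α _ hβ))
  have hlow' := hlow (lasso α _ hβ)
  have hreal := EReal.coe_toReal hne_top hne_bot
  rw [← hreal, EReal.coe_le_coe_iff] at hup hlow'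
  refine ⟨α, _, hβ, μ, _, hinf, hreal.symm, ?_⟩
  rw [abs_lt]
  constructor <;> linarith
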